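/- **Setting.** All Hilbert spaces are complex and finite-dimensional, with inner products linear in the second variable; $B(\mathcal K,\mathcal H)$ denotes the linear operators $\mathcal K\to\mathcal H$, $B(\mathcal K)=B(\mathcal K,\mathcal K)$, and $B(\mathcal K)_+$ the positive semidefinite ones. For $x\in\mathcal H$, $\xi\in\mathcal K$ let $x\xi^*\in B(\mathcal K,\mathcal H)$ be $\zeta\mapsto\langle\xi,\zeta\rangle x$. Let $\mathcal K_1,\mathcal K_2,\mathcal H_1,\mathcal H_2$ carry fixed antilinear isometric involutions $x\mapsto\overline x$; equip $\mathcal K=\mathcal K_1\oplus\mathcal K_2\oplus\mathbb C$ and $\mathcal H=\mathcal H_1\oplus\mathcal H_2\oplus\mathbb C$ with the direct sum involutions, where $\mathbb C$ carries complex conjugation. The transpose of an operator $X$ is $X^{\mathrm T}x=\overline{X^*\overline x}$. Write $X\in B(\mathcal K)$ in blocks $(X_{ij})_{i,j=1,2,3}$. A linear map $\phi:B(\mathcal K)\to B(\mathcal H)$ is positive if $\phi(B(\mathcal K)_+)\subset B(\mathcal H)_+$; $\mathbb P$ is the cone of positive maps. Let $\mathbb S\subset B(\mathcal K)\otimes B(\mathcal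 H)$ be the cone of finite sums $\sum_i X_i\otimes Y_i$ with $X_i\in B(\mathcal K)_+$, $Y_i\in B(\mathcal H)_+$, and let $\langle\cdot,\cdot\rangle_{\mathrm d}$ be the bilinear pairing with $\langle\phi,X\otimes Y\rangle_{\mathrm d}=\operatorname{Tr}(\phi(X)Y^{\mathrm T})$. A map $\phi\in\mathbb P$ is an *exposed positive map* if there is $Z_0\in\mathbb S$ with $\{c\,\phi: c\ge 0\}=\{\psi\in\mathbb P:\langle\psi,Z_0\rangle_{\mathrm d}=0\}$. **Theorem.** Let $A_1\in B(\mathcal K_1,\mathcal H_1)$ and $A_2\in B(\mathcal K_2,\mathcal H_2)$ be nonzero, and let $P_i$ be the orthogonal projection of $\mathcal H_i$ onto the range of $A_i$. 1. For all $\theta_1,\theta_2,\nu\in\mathbb R$ with $\nu>0$, the map $\phi:B(\mathcal K)\to B(\mathcal H)$, $$\phi(X)=\begin{pmatrix}A_1X_{11}A_1^*+\nu\operatorname{Tr}(A_2X_{22}^{\mathrm T}A_2^*)P_1&0&e^{i\theta_1}A_1X_{13}\\0&A_2X_{22}^{\mathrm T}A_2^*+\nu^{-1}\operatorname{Tr}(A_1X_{11}A_1^*)P_2&e^{i\theta_2}A_2X_{32}^{\mathrm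 T}\\e^{-i\theta_1}X_{31}A_1^*&e^{-i\theta_2}X_{23}^{\mathrm T}A_2^*&X_{33}\end{pmatrix},$$ is an exposed positive map. 2. In particular, every canonical merging of $\phi_1(X)=A_1XA_1^*$ and $\phi_2(X)=A_2X^{\mathrm T}A_2^*$ is an exposed positive map. Here a *canonical merging* of $\phi_1$ and $\phi_2$ is defined as follows. Choose unit vectors $\xi_i\in\mathcal K_i$, $x_i\in\mathcal H_i$ and $\lambda_i>0$ with $\phi_i(\xi_i\xi_i^*)x_i=\lambda_ix_i$ ($i=1,2$). Put $B_1\eta=\lambda_1^{-1/2}\phi_1(\eta\xi_1^*)x_1$, $C_2\eta=\lambda_2^{-1/2}\phi_2(\xi_2\overline{\eta}^*)x_2$, $\omega_1(X)=\operatorname{Tr}(B_1XB_1^*)$, $\omega_2(X)=\operatorname{Tr}(C_2X^{\mathrm T}C_2^*)$, and let $Q_i$ be the orthogonal projection onto the range of $\phi_i(\mathrm{id}_{\mathcal K_i})$. The canonical merging is the map $$X\mapsto\begin{pmatrix}\phi_1(X_{11})+\omega_2(X_{22})Q_1&0&B_1X_{13}\\0&\phi_2(X_{22})+\omega_1(X_{11})Q_2&C_2X_{32}^{\mathrm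 T}\\X_{31}B_1^*&X_{23}^{\mathrm T}C_2^*&X_{33}\end{pmatrix}.$$ -/

import Mathlib

open scoped InnerProductSpace TensorProduct

namespace Merging

noncomputable section

/-- An antilinear isometric involution `x ↦ x̄` of a complex inner product space. -/
structure Conjugation (E : Type*) [NormedAddCommGroup E] [InnerProductSpace ℂ E] where
  conj : E →ₗ⋆[ℂ] E
  norm_conj : ∀ x, ‖conj x‖ = ‖x‖
  conj_conj : ∀ x, conj (conj x) = x

section Basic

variable {E F : Type*}
  [NormedAddCommGroup E] [InnerProductSpace ℂ E] [FiniteDimensional ℂ E]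
  [NormedAddCommGroup F] [InnerProductSpace ℂ F] [FiniteDimensional ℂ F]

/-- The transpose `Xᵀ x = conj (X* (conj x))` of `X : E → F` with respect to conjugations of
`E` and `F`, as a linear map `B(E, F) → B(F, E)`. -/
def transpose (JE : Conjugation E) (JF : Conjugation F) :
    (E →ₗ[ℂ] F) →ₗ[ℂ] (F →ₗ[ℂ] E) where
  toFun X := JE.conj.comp ((LinearMap.adjoint X).comp JF.conj)
  map_add' X Y := by
    ext z
    simp
  map_smul' c X := by
    ext z
    simp [map_smulₛₗ]

/-- The rank one operator `x ξ* : ζ ↦ ⟪ξ, ζ⟫ x`. -/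
def ketBra (x : F) (ξ : E) : E →ₗ[ℂ] F :=
  (InnerProductSpace.rankOne ℂ x ξ).toLinearMap

/-- The orthogonal projection onto a subspace `U`, as an operator on the whole space. -/
def proj (U : Submodule ℂ E) : E →ₗ[ℂ] E := U.starProjection.toLinearMap

variable (E F) in
/-- The cone of positive maps `B(E) → B(F)`. -/
def positiveMaps : Set ((E →ₗ[ℂ] E) →ₗ[ℂ] (F →ₗ[ℂ] F)) :=
  {φ | ∀ X : E →ₗ[ℂ] E, X.IsPositive → (φ X).IsPositive}

variable (E F) in
/-- The cone of (unnormalized) separable operators in `B(E) ⊗ B(F)`. -/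
def separable : Set ((E →ₗ[ℂ] E) ⊗[ℂ] (F →ₗ[ℂ] F)) :=
  {Z | ∃ (n : ℕ) (X : Fin n → (E →ₗ[ℂ] E)) (Y : Fin n → (F →ₗ[ℂ] F)),
    (∀ i, (X i).IsPositive) ∧ (∀ i, (Y i).IsPositive) ∧ Z = ∑ i, X i ⊗ₜ[ℂ] Y i}

/-- The pairing determined by `⟨φ, X ⊗ Y⟩ = Tr (φ(X) Yᵀ)`, as a linear functional of
`Z ∈ B(E) ⊗ B(F)`. -/
def pairing (JF : Conjugation F) (φ : (E →ₗ[ℂ] E) →ₗ[ℂ] (F →ₗ[ℂ] F)) :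
    (E →ₗ[ℂ] E) ⊗[ℂ] (F →ₗ[ℂ] F) →ₗ[ℂ] ℂ :=
  TensorProduct.lift
    (((LinearMap.mul ℂ (F →ₗ[ℂ] F)).compr₂ (LinearMap.trace ℂ F)).compl₁₂ φ (transpose JF JF))

/-- `φ` is an exposed positive map: it is positive, and for some separable `Z₀` the ray `ℝ₊ φ`
is exactly the set of all positive maps annihilated by `Z₀`. -/
def IsExposedPositive (JF : Conjugation F) (φ : (E →ₗ[ℂ] E) →ₗ[ℂ] (F →ₗ[ℂ] F)) : Prop :=
  φ ∈ positiveMaps E F ∧ ∃ Z₀ ∈ separable E F,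
    {ψ | ∃ c : ℝ, 0 ≤ c ∧ ψ = (c : ℂ) • φ} = {ψ ∈ positiveMaps E F | pairing JF ψ Z₀ = 0}

end Basic

section Sum

/-- The Hilbert space direct sum `E₁ ⊕ E₂ ⊕ ℂ`. -/
abbrev Sum₃ (E₁ E₂ : Type*) := WithLp 2 (E₁ × WithLp 2 (E₂ × ℂ))

variable {E₁ E₂ : Type*}
  [NormedAddCommGroup E₁] [InnerProductSpace ℂ E₁] [NormedAddCommGroup E₂] [InnerProductSpace ℂ E₂]

/-- The conjugation of `E₁ ⊕ E₂ ⊕ ℂ` which extends the given ones and fixes `1 ∈ ℂ`. -/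
def Conjugation.sum₃ (J₁ : Conjugation E₁) (J₂ : Conjugation E₂) :
    Conjugation (Sum₃ E₁ E₂) where
  conj :=
    { toFun := fun x => WithLp.toLp 2
        (J₁.conj x.fst, WithLp.toLp 2 (J₂.conj x.snd.fst, starRingEnd ℂ x.snd.snd))
      map_add' := fun x y => by
        simp only [WithLp.add_fst, WithLp.add_snd, map_add]
        rfl
      map_smul' := fun c x => by
        simp only [WithLp.smul_fst, WithLp.smul_snd, map_smulₛₗ, smul_eq_mul, map_mul]
        rfl }
  norm_conj x := by
    simp [WithLp.prod_norm_eq_of_L2, J₁.norm_conj, J₂.norm_conj]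
  conj_conj x := by
    change WithLp.toLp 2 (J₁.conj (J₁.conj x.fst), WithLp.toLp 2
      (J₂.conj (J₂.conj x.snd.fst), starRingEnd ℂ (starRingEnd ℂ x.snd.snd))) = x
    rw [J₁.conj_conj, J₂.conj_conj, Complex.conj_conj]
    rfl

/-- The conjugation `z ↦ z̄` of `ℂ`. -/
def Conjugation.complex : Conjugation ℂ where
  conj :=
    { toFun := fun z => starRingEnd ℂ z
      map_add' := fun x y => map_add _ x y
      map_smul' := fun c x => by simp }
  norm_conj x := by simp
  conj_conj x := by simp

variable (E₁ E₂) in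
/-- The embedding of the first summand. -/
def inj₁ : E₁ →ₗ[ℂ] Sum₃ E₁ E₂ :=
  (WithLp.linearEquiv 2 ℂ (E₁ × WithLp 2 (E₂ × ℂ))).symm.toLinearMap ∘ₗ LinearMap.inl ℂ _ _

variable (E₁ E₂) in
/-- The embedding of the second summand. -/
def inj₂ : E₂ →ₗ[ℂ] Sum₃ E₁ E₂ :=
  (WithLp.linearEquiv 2 ℂ (E₁ × WithLp 2 (E₂ × ℂ))).symm.toLinearMap ∘ₗ LinearMap.inr ℂ _ _ ∘ₗ
    (WithLp.linearEquiv 2 ℂ (E₂ × ℂ)).symm.toLinearMap ∘ₗ LinearMap.inl ℂ _ _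

variable (E₁ E₂) in
/-- The embedding of the third summand. -/
def inj₃ : ℂ →ₗ[ℂ] Sum₃ E₁ E₂ :=
  (WithLp.linearEquiv 2 ℂ (E₁ × WithLp 2 (E₂ × ℂ))).symm.toLinearMap ∘ₗ LinearMap.inr ℂ _ _ ∘ₗ
    (WithLp.linearEquiv 2 ℂ (E₂ × ℂ)).symm.toLinearMap ∘ₗ LinearMap.inr ℂ _ _

variable (E₁ E₂) in
/-- The coordinate map onto the first summand. -/
def pr₁ : Sum₃ E₁ E₂ →ₗ[ℂ] E₁ := WithLp.fstₗ 2 ℂ E₁ (WithLp 2 (E₂ × ℂ))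

variable (E₁ E₂) in
/-- The coordinate map onto the second summand. -/
def pr₂ : Sum₃ E₁ E₂ →ₗ[ℂ] E₂ :=
  WithLp.fstₗ 2 ℂ E₂ ℂ ∘ₗ WithLp.sndₗ 2 ℂ E₁ (WithLp 2 (E₂ × ℂ))

variable (E₁ E₂) in
/-- The coordinate map onto the third summand. -/
def pr₃ : Sum₃ E₁ E₂ →ₗ[ℂ] ℂ :=
  WithLp.sndₗ 2 ℂ E₂ ℂ ∘ₗ WithLp.sndₗ 2 ℂ E₁ (WithLp 2 (E₂ × ℂ))

/-- The operator on `E₁ ⊕ E₂ ⊕ ℂ` with the block matrix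
`(Y₁₁ Y₁₂ Y₁₃ ; Y₂₁ Y₂₂ Y₂₃ ; Y₃₁ Y₃₂ Y₃₃)`, listed row by row. -/
def ofBlocks
    (Y₁₁ : E₁ →ₗ[ℂ] E₁) (Y₁₂ : E₂ →ₗ[ℂ] E₁) (Y₁₃ : ℂ →ₗ[ℂ] E₁)
    (Y₂₁ : E₁ →ₗ[ℂ] E₂) (Y₂₂ : E₂ →ₗ[ℂ] E₂) (Y₂₃ : ℂ →ₗ[ℂ] E₂)
    (Y₃₁ : E₁ →ₗ[ℂ] ℂ) (Y₃₂ : E₂ →ₗ[ℂ] ℂ) (Y₃₃ : ℂ →ₗ[ℂ] ℂ) :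
    Sum₃ E₁ E₂ →ₗ[ℂ] Sum₃ E₁ E₂ :=
  inj₁ E₁ E₂ ∘ₗ (Y₁₁ ∘ₗ pr₁ E₁ E₂ + Y₁₂ ∘ₗ pr₂ E₁ E₂ + Y₁₃ ∘ₗ pr₃ E₁ E₂) +
  inj₂ E₁ E₂ ∘ₗ (Y₂₁ ∘ₗ pr₁ E₁ E₂ + Y₂₂ ∘ₗ pr₂ E₁ E₂ + Y₂₃ ∘ₗ pr₃ E₁ E₂) +
  inj₃ E₁ E₂ ∘ₗ (Y₃₁ ∘ₗ pr₁ E₁ E₂ + Y₃₂ ∘ₗ pr₂ E₁ E₂ + Y₃₃ ∘ₗ pr₃ E₁ E₂)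

/-- The blocks `Xᵢⱼ` of an operator on `E₁ ⊕ E₂ ⊕ ℂ` (those that are needed). -/
def block₁₁ (X : Sum₃ E₁ E₂ →ₗ[ℂ] Sum₃ E₁ E₂) : E₁ →ₗ[ℂ] E₁ := pr₁ E₁ E₂ ∘ₗ X ∘ₗ inj₁ E₁ E₂
def block₁₃ (X : Sum₃ E₁ E₂ →ₗ[ℂ] Sum₃ E₁ E₂) : ℂ →ₗ[ℂ] E₁ := pr₁ E₁ E₂ ∘ₗ X ∘ₗ inj₃ E₁ E₂
def block₂₂ (X : Sum₃ E₁ E₂ →ₗ[ℂ] Sum₃ E₁ E₂) : E₂ →ₗ[ℂ] E₂ := pr₂ E₁ E₂ ∘ₗ X ∘ₗ inj₂ E₁ E₂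
def block₂₃ (X : Sum₃ E₁ E₂ →ₗ[ℂ] Sum₃ E₁ E₂) : ℂ →ₗ[ℂ] E₂ := pr₂ E₁ E₂ ∘ₗ X ∘ₗ inj₃ E₁ E₂
def block₃₁ (X : Sum₃ E₁ E₂ →ₗ[ℂ] Sum₃ E₁ E₂) : E₁ →ₗ[ℂ] ℂ := pr₃ E₁ E₂ ∘ₗ X ∘ₗ inj₁ E₁ E₂
def block₃₂ (X : Sum₃ E₁ E₂ →ₗ[ℂ] Sum₃ E₁ E₂) : E₂ →ₗ[ℂ] ℂ := pr₃ E₁ E₂ ∘ₗ X ∘ₗ inj₂ E₁ E₂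
def block₃₃ (X : Sum₃ E₁ E₂ →ₗ[ℂ] Sum₃ E₁ E₂) : ℂ →ₗ[ℂ] ℂ := pr₃ E₁ E₂ ∘ₗ X ∘ₗ inj₃ E₁ E₂

theorem block₁₁_add (X Y : Sum₃ E₁ E₂ →ₗ[ℂ] Sum₃ E₁ E₂) :
    block₁₁ (X + Y) = block₁₁ X + block₁₁ Y := by
  simp only [block₁₁, LinearMap.add_comp, LinearMap.comp_add]

theorem block₁₁_smul (c : ℂ) (X : Sum₃ E₁ E₂ →ₗ[ℂ] Sum₃ E₁ E₂) :
    block₁₁ (c • X) = c • block₁₁ X := by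
  simp only [block₁₁, LinearMap.smul_comp, LinearMap.comp_smul]

theorem block₁₃_add (X Y : Sum₃ E₁ E₂ →ₗ[ℂ] Sum₃ E₁ E₂) :
    block₁₃ (X + Y) = block₁₃ X + block₁₃ Y := by
  simp only [block₁₃, LinearMap.add_comp, LinearMap.comp_add]

theorem block₁₃_smul (c : ℂ) (X : Sum₃ E₁ E₂ →ₗ[ℂ] Sum₃ E₁ E₂) :
    block₁₃ (c • X) = c • block₁₃ X := by
  simp only [block₁₃, LinearMap.smul_comp, LinearMap.comp_smul]

theorem block₂₂_add (X Y : Sum₃ E₁ E₂ →ₗ[ℂ] Sum₃ E₁ E₂) :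
    block₂₂ (X + Y) = block₂₂ X + block₂₂ Y := by
  simp only [block₂₂, LinearMap.add_comp, LinearMap.comp_add]

theorem block₂₂_smul (c : ℂ) (X : Sum₃ E₁ E₂ →ₗ[ℂ] Sum₃ E₁ E₂) :
    block₂₂ (c • X) = c • block₂₂ X := by
  simp only [block₂₂, LinearMap.smul_comp, LinearMap.comp_smul]

theorem block₂₃_add (X Y : Sum₃ E₁ E₂ →ₗ[ℂ] Sum₃ E₁ E₂) :
    block₂₃ (X + Y) = block₂₃ X + block₂₃ Y := by
  simp only [block₂₃, LinearMap.add_comp, LinearMap.comp_add]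

theorem block₂₃_smul (c : ℂ) (X : Sum₃ E₁ E₂ →ₗ[ℂ] Sum₃ E₁ E₂) :
    block₂₃ (c • X) = c • block₂₃ X := by
  simp only [block₂₃, LinearMap.smul_comp, LinearMap.comp_smul]

theorem block₃₁_add (X Y : Sum₃ E₁ E₂ →ₗ[ℂ] Sum₃ E₁ E₂) :
    block₃₁ (X + Y) = block₃₁ X + block₃₁ Y := by
  simp only [block₃₁, LinearMap.add_comp, LinearMap.comp_add]

theorem block₃₁_smul (c : ℂ) (X : Sum₃ E₁ E₂ →ₗ[ℂ] Sum₃ E₁ E₂) :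
    block₃₁ (c • X) = c • block₃₁ X := by
  simp only [block₃₁, LinearMap.smul_comp, LinearMap.comp_smul]

theorem block₃₂_add (X Y : Sum₃ E₁ E₂ →ₗ[ℂ] Sum₃ E₁ E₂) :
    block₃₂ (X + Y) = block₃₂ X + block₃₂ Y := by
  simp only [block₃₂, LinearMap.add_comp, LinearMap.comp_add]

theorem block₃₂_smul (c : ℂ) (X : Sum₃ E₁ E₂ →ₗ[ℂ] Sum₃ E₁ E₂) :
    block₃₂ (c • X) = c • block₃₂ X := by
  simp only [block₃₂, LinearMap.smul_comp, LinearMap.comp_smul]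

theorem block₃₃_add (X Y : Sum₃ E₁ E₂ →ₗ[ℂ] Sum₃ E₁ E₂) :
    block₃₃ (X + Y) = block₃₃ X + block₃₃ Y := by
  simp only [block₃₃, LinearMap.add_comp, LinearMap.comp_add]

theorem block₃₃_smul (c : ℂ) (X : Sum₃ E₁ E₂ →ₗ[ℂ] Sum₃ E₁ E₂) :
    block₃₃ (c • X) = c • block₃₃ X := by
  simp only [block₃₃, LinearMap.smul_comp, LinearMap.comp_smul]

end Sum

section Maps

variable {K₁ K₂ H₁ H₂ : Type*}
  [NormedAddCommGroup K₁] [InnerProductSpace ℂ K₁] [FiniteDimensional ℂ K₁]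
  [NormedAddCommGroup K₂] [InnerProductSpace ℂ K₂] [FiniteDimensional ℂ K₂]
  [NormedAddCommGroup H₁] [InnerProductSpace ℂ H₁] [FiniteDimensional ℂ H₁]
  [NormedAddCommGroup H₂] [InnerProductSpace ℂ H₂] [FiniteDimensional ℂ H₂]

/-- The map `X ↦ A X A*`. -/
def adMap (A : K₁ →ₗ[ℂ] H₁) : (K₁ →ₗ[ℂ] K₁) →ₗ[ℂ] (H₁ →ₗ[ℂ] H₁) where
  toFun X := A ∘ₗ X ∘ₗ LinearMap.adjoint A
  map_add' X Y := by
    ext z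
    simp
  map_smul' c X := by
    ext z
    simp

/-- The map `X ↦ A Xᵀ A*`. -/
def coAdMap (J : Conjugation K₁) (A : K₁ →ₗ[ℂ] H₁) : (K₁ →ₗ[ℂ] K₁) →ₗ[ℂ] (H₁ →ₗ[ℂ] H₁) :=
  adMap A ∘ₗ transpose J J

/-- The map `φ : B(K₁ ⊕ K₂ ⊕ ℂ) → B(H₁ ⊕ H₂ ⊕ ℂ)` given in block form, where `Pᵢ` is the orthogonal
projection onto the range of `Aᵢ`. -/
def blockMap (J₂ : Conjugation K₂)
    (A₁ : K₁ →ₗ[ℂ] H₁) (A₂ : K₂ →ₗ[ℂ] H₂) (θ₁ θ₂ ν : ℝ) :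
    (Sum₃ K₁ K₂ →ₗ[ℂ] Sum₃ K₁ K₂) →ₗ[ℂ] (Sum₃ H₁ H₂ →ₗ[ℂ] Sum₃ H₁ H₂) where
  toFun X := ofBlocks
    (A₁ ∘ₗ block₁₁ X ∘ₗ LinearMap.adjoint A₁ +
      ((ν : ℂ) * LinearMap.trace ℂ H₂
        (A₂ ∘ₗ transpose J₂ J₂ (block₂₂ X) ∘ₗ LinearMap.adjoint A₂)) • proj (LinearMap.range A₁))
    0
    (Complex.exp (θ₁ * Complex.I) • (A₁ ∘ₗ block₁₃ X))
    0
    (A₂ ∘ₗ transpose J₂ J₂ (block₂₂ X) ∘ₗ LinearMap.adjoint A₂ +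
      ((ν : ℂ)⁻¹ * LinearMap.trace ℂ H₁
        (A₁ ∘ₗ block₁₁ X ∘ₗ LinearMap.adjoint A₁)) • proj (LinearMap.range A₂))
    (Complex.exp (θ₂ * Complex.I) • (A₂ ∘ₗ transpose J₂ Conjugation.complex (block₃₂ X)))
    (Complex.exp (-(θ₁ * Complex.I)) • (block₃₁ X ∘ₗ LinearMap.adjoint A₁))
    (Complex.exp (-(θ₂ * Complex.I)) •
      (transpose Conjugation.complex J₂ (block₂₃ X) ∘ₗ LinearMap.adjoint A₂))
    (block₃₃ X)
  map_add' X Y := by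
    simp only [ofBlocks, block₁₁_add, block₁₃_add, block₂₂_add, block₂₃_add, block₃₁_add,
      block₃₂_add, block₃₃_add, LinearMap.zero_comp, add_zero, zero_add,
      map_add, LinearMap.comp_add, LinearMap.add_comp, smul_add, mul_add,
      add_smul]
    abel
  map_smul' c X := by
    simp only [ofBlocks, block₁₁_smul, block₁₃_smul, block₂₂_smul, block₂₃_smul, block₃₁_smul,
      block₃₂_smul, block₃₃_smul, LinearMap.zero_comp, add_zero, zero_add,
      map_smul, LinearMap.comp_smul, LinearMap.smul_comp, smul_add,
      LinearMap.comp_add, LinearMap.add_comp, RingHom.id_apply, smul_eq_mul, smul_smul,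
      mul_comm c, mul_assoc]

/-- The merging of `φ₁` and `φ₂` by means of operators `Bᵢ`, `Cᵢ` and functionals `ωᵢ`; here `Pᵢ`
is the orthogonal projection onto the range of `φᵢ(1)`. -/
def merging (J₁ : Conjugation K₁) (J₂ : Conjugation K₂)
    (φ₁ : (K₁ →ₗ[ℂ] K₁) →ₗ[ℂ] (H₁ →ₗ[ℂ] H₁)) (φ₂ : (K₂ →ₗ[ℂ] K₂) →ₗ[ℂ] (H₂ →ₗ[ℂ] H₂))
    (B₁ C₁ : K₁ →ₗ[ℂ] H₁) (B₂ C₂ : K₂ →ₗ[ℂ] H₂)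
    (ω₁ : (K₁ →ₗ[ℂ] K₁) →ₗ[ℂ] ℂ) (ω₂ : (K₂ →ₗ[ℂ] K₂) →ₗ[ℂ] ℂ) :
    (Sum₃ K₁ K₂ →ₗ[ℂ] Sum₃ K₁ K₂) →ₗ[ℂ] (Sum₃ H₁ H₂ →ₗ[ℂ] Sum₃ H₁ H₂) where
  toFun X := ofBlocks
    (φ₁ (block₁₁ X) + ω₂ (block₂₂ X) • proj (LinearMap.range (φ₁ LinearMap.id)))
    0
    (B₁ ∘ₗ block₁₃ X + C₁ ∘ₗ transpose J₁ Conjugation.complex (block₃₁ X))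
    0
    (φ₂ (block₂₂ X) + ω₁ (block₁₁ X) • proj (LinearMap.range (φ₂ LinearMap.id)))
    (B₂ ∘ₗ block₂₃ X + C₂ ∘ₗ transpose J₂ Conjugation.complex (block₃₂ X))
    (block₃₁ X ∘ₗ LinearMap.adjoint B₁ +
      transpose Conjugation.complex J₁ (block₁₃ X) ∘ₗ LinearMap.adjoint C₁)
    (block₃₂ X ∘ₗ LinearMap.adjoint B₂ +
      transpose Conjugation.complex J₂ (block₂₃ X) ∘ₗ LinearMap.adjoint C₂)
    (block₃₃ X)
  map_add' X Y := by
    simp only [ofBlocks, block₁₁_add, block₁₃_add, block₂₂_add, block₂₃_add, block₃₁_add,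
      block₃₂_add, block₃₃_add, LinearMap.zero_comp, add_zero, zero_add,
      map_add, LinearMap.comp_add, LinearMap.add_comp, add_smul]
    abel
  map_smul' c X := by
    simp only [ofBlocks, block₁₁_smul, block₁₃_smul, block₂₂_smul, block₂₃_smul, block₃₁_smul,
      block₃₂_smul, block₃₃_smul, LinearMap.zero_comp, add_zero, zero_add,
      map_smul, LinearMap.comp_smul, LinearMap.smul_comp, smul_add,
      LinearMap.comp_add, LinearMap.add_comp, RingHom.id_apply, smul_eq_mul, smul_smul]

/-- The operator `B η = r^{-1/2} φ(η ξ*) x`. -/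
def opB (φ : (K₁ →ₗ[ℂ] K₁) →ₗ[ℂ] (H₁ →ₗ[ℂ] H₁)) (ξ : K₁) (x : H₁) (r : ℝ) : K₁ →ₗ[ℂ] H₁ where
  toFun η := ((Real.sqrt r)⁻¹ : ℂ) • φ (ketBra η ξ) x
  map_add' η ζ := by simp [ketBra]
  map_smul' c η := by simp [ketBra, smul_comm c]

/-- The operator `C η = r^{-1/2} φ(ξ (conj η)*) x`. -/
def opC (J : Conjugation K₁) (φ : (K₁ →ₗ[ℂ] K₁) →ₗ[ℂ] (H₁ →ₗ[ℂ] H₁)) (ξ : K₁) (x : H₁) (r : ℝ) :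
    K₁ →ₗ[ℂ] H₁ where
  toFun η := ((Real.sqrt r)⁻¹ : ℂ) • φ (ketBra ξ (J.conj η)) x
  map_add' η ζ := by simp [ketBra]
  map_smul' c η := by simp [ketBra, smul_comm c]

/-- `φ` is a canonical merging of `φ₁` and `φ₂`: for some unit vectors `ξᵢ`, `xᵢ` and positive
numbers `rᵢ` with `φᵢ(ξᵢ ξᵢ*) xᵢ = rᵢ xᵢ`, it is the merging of `φ₁` and `φ₂` by means of
`B₁ η = r₁^{-1/2} φ₁(η ξ₁*) x₁`, `C₁ = 0`, `B₂ = 0`, `C₂ η = r₂^{-1/2} φ₂(ξ₂ (conj η)*) x₂`,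
`ω₁(X) = Tr (B₁ X B₁*)`, `ω₂(X) = Tr (C₂ Xᵀ C₂*)`. -/
def IsCanonicalMerging (J₁ : Conjugation K₁) (J₂ : Conjugation K₂)
    (φ₁ : (K₁ →ₗ[ℂ] K₁) →ₗ[ℂ] (H₁ →ₗ[ℂ] H₁)) (φ₂ : (K₂ →ₗ[ℂ] K₂) →ₗ[ℂ] (H₂ →ₗ[ℂ] H₂))
    (φ : (Sum₃ K₁ K₂ →ₗ[ℂ] Sum₃ K₁ K₂) →ₗ[ℂ] (Sum₃ H₁ H₂ →ₗ[ℂ] Sum₃ H₁ H₂)) : Prop :=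
  ∃ (ξ₁ : K₁) (x₁ : H₁) (r₁ : ℝ) (ξ₂ : K₂) (x₂ : H₂) (r₂ : ℝ),
    ‖ξ₁‖ = 1 ∧ ‖x₁‖ = 1 ∧ 0 < r₁ ∧ φ₁ (ketBra ξ₁ ξ₁) x₁ = (r₁ : ℂ) • x₁ ∧
    ‖ξ₂‖ = 1 ∧ ‖x₂‖ = 1 ∧ 0 < r₂ ∧ φ₂ (ketBra ξ₂ ξ₂) x₂ = (r₂ : ℂ) • x₂ ∧
    φ = merging J₁ J₂ φ₁ φ₂ (opB φ₁ ξ₁ x₁ r₁) 0 0 (opC J₂ φ₂ ξ₂ x₂ r₂)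
      (LinearMap.trace ℂ H₁ ∘ₗ adMap (opB φ₁ ξ₁ x₁ r₁))
      (LinearMap.trace ℂ H₂ ∘ₗ coAdMap J₂ (opC J₂ φ₂ ξ₂ x₂ r₂))

end Maps

end

end Merging

/-! A positive map `φ` is exposed once its zeros, the pairs `(η, h)` with `φ(ηη*)h = 0`, determine
it among positive maps up to a nonnegative factor. Indeed, let `Z₀` be the sum of finitely many
tensors `ηη* ⊗ h̄h̄*` spanning all those that come from zeros. Each term pairs nonnegatively with a
positive `ψ`, so `⟨ψ, Z₀⟩ = 0` forces every zero of `φ` on `ψ` (`isExposedPositive_of_zeros`).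

For `η = (η₁, η₂, t)` put `a = e^{iθ₁} A₁ η₁`, linear in `η₁`, and `b = e^{iθ₂} A₂ η̄₂`, antilinear
in `η₂`. The quadratic form of `φ(ηη*)` at `h = (x, y, s)` dominates a sum of two squares, by
Cauchy–Schwarz (`blockMap_mem_positiveMaps`). It vanishes for `t = 1` and `h = (-a, -νb, ‖a‖² +
ν‖b‖²)`, and at several vectors `h` with `s = 0` subject to orthogonality conditions.

Let a positive `ψ` share these zeros, and let `χ = ψ - cφ`, with `c` the last diagonal entry of `ψ`
at the last matrix unit. Scaling `η₁, η₂` by complex numbers `z, w` in the generic zero gives a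
polynomial identity in `z, z̄, w, w̄`. Its coefficients, polarization and the orthogonal zeros
annihilate `χ` block by block (`eq_zero_of_common_zeros`).

For a canonical merging, the eigenvector equations make `B₁` and `C₂` equal to `A₁` and `A₂` up to
phases, so it is a block map with `ν = 1`. -/

open scoped InnerProductSpace TensorProduct

namespace Merging

/-! ### Rank one operators and polarization. -/

section RankOne

variable {E F : Type*}
  [NormedAddCommGroup E] [InnerProductSpace ℂ E] [NormedAddCommGroup F] [InnerProductSpace ℂ F]

theorem ketBra_apply (x : F) (ξ ζ : E) : ketBra x ξ ζ = ⟪ξ, ζ⟫_ℂ • x := rfl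

theorem ketBra_add_left (x y : F) (ξ : E) : ketBra (x + y) ξ = ketBra x ξ + ketBra y ξ := by
  ext z; simp [ketBra_apply]

theorem ketBra_add_right (x : F) (ξ ζ : E) : ketBra x (ξ + ζ) = ketBra x ξ + ketBra x ζ := by
  ext z; simp [ketBra_apply, add_smul]

theorem ketBra_smul_left (c : ℂ) (x : F) (ξ : E) : ketBra (c • x) ξ = c • ketBra x ξ := by
  ext z; simp [ketBra_apply, smul_comm c]

theorem ketBra_smul_right (c : ℂ) (x : F) (ξ : E) :
    ketBra x (c • ξ) = starRingEnd ℂ c • ketBra x ξ := by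
  ext z
  simp only [ketBra_apply, inner_smul_left, mul_smul, LinearMap.smul_apply]

/-- A sesquilinear expression that vanishes on the diagonal vanishes. -/
theorem eq_zero_of_diagonal {M V : Type*} [AddCommGroup M] [Module ℂ M] [AddCommGroup V]
    [Module ℂ V] (D : M → M → V) (hdiag : ∀ x, D x x = 0)
    (hD : ∀ x y (c : ℂ), D (x + c • y) (x + c • y) =
      D x x + c • D x y + starRingEnd ℂ c • D y x + (c * starRingEnd ℂ c) • D y y) (x y : M) :
    D x y = 0 := by
  have h1 := hD x y 1
  have h2 := hD x y Complex.I
  simp only [hdiag, map_one, one_smul, smul_zero, add_zero, zero_add, Complex.conj_I,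
    neg_smul] at h1 h2
  have h3 : D x y = D y x := by
    rw [← sub_eq_add_neg, ← smul_sub, eq_comm, smul_eq_zero] at h2
    exact sub_eq_zero.mp (h2.resolve_left Complex.I_ne_zero)
  rw [← h3, eq_comm, ← two_smul ℂ] at h1
  exact (smul_eq_zero.mp h1).resolve_left two_ne_zero

end RankOne

/-! ### Positive maps, their zeros, and a criterion for exposedness. -/

section Exposed

open scoped ComplexOrder

variable {E F : Type*}
  [NormedAddCommGroup E] [InnerProductSpace ℂ E] [FiniteDimensional ℂ E]
  [NormedAddCommGroup F] [InnerProductSpace ℂ F] [FiniteDimensional ℂ F]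

theorem adjoint_ketBra (x : F) (ξ : E) : LinearMap.adjoint (ketBra x ξ) = ketBra ξ x := by
  rw [eq_comm, LinearMap.eq_adjoint_iff]
  intro y z
  simp only [ketBra_apply, inner_smul_left, inner_smul_right, inner_conj_symm]
  ring

theorem trace_ketBra (x y : E) : LinearMap.trace ℂ E (ketBra x y) = ⟪y, x⟫_ℂ :=
  InnerProductSpace.trace_rankOne x y

theorem isPositive_ketBra (x : E) : (ketBra x x).IsPositive :=
  InnerProductSpace.isPositive_rankOne_self x

theorem exists_sum_ketBra {T : E →ₗ[ℂ] E} (hT : T.IsPositive) :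
    ∃ (n : ℕ) (u : Fin n → E), T = ∑ i, ketBra (u i) (u i) := by
  obtain ⟨n, u, hu⟩ := ContinuousLinearMap.isPositive_iff_eq_sum_rankOne.mp
    (LinearMap.isPositive_toContinuousLinearMap_iff T |>.mpr hT)
  refine ⟨n, u, ?_⟩
  ext z
  have := congrArg (fun S : E →L[ℂ] E => S z) hu
  simpa [ketBra_apply] using this

/-- Writing `T = ∑ uᵢuᵢ*`, the form is `∑ |⟨uᵢ, h⟩|²`, so every `⟨uᵢ, h⟩` vanishes. -/
theorem apply_eq_zero_of_inner_eq_zero {T : E →ₗ[ℂ] E} (hT : T.IsPositive) {h : E}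
    (hh : ⟪h, T h⟫_ℂ = 0) : T h = 0 := by
  obtain ⟨n, u, rfl⟩ := exists_sum_ketBra hT
  have key : ((∑ i, ‖⟪u i, h⟫_ℂ‖ ^ 2 : ℝ) : ℂ) = 0 := by
    rw [← hh]
    simp only [LinearMap.sum_apply, ketBra_apply, inner_sum, inner_smul_right]
    push_cast
    refine Finset.sum_congr rfl fun i _ => ?_
    rw [← inner_conj_symm h (u i), Complex.mul_conj']
  have key' := (Finset.sum_eq_zero_iff_of_nonneg (fun i _ => by positivity)).mp
    (Complex.ofReal_eq_zero.mp key)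
  simp only [LinearMap.sum_apply, ketBra_apply]
  refine Finset.sum_eq_zero fun i hi => ?_
  have := key' i hi
  rw [norm_eq_zero.mp (pow_eq_zero_iff two_ne_zero |>.mp this), zero_smul]

theorem mem_positiveMaps_of_ketBra {φ : (E →ₗ[ℂ] E) →ₗ[ℂ] (F →ₗ[ℂ] F)}
    (h : ∀ η, (φ (ketBra η η)).IsPositive) : φ ∈ positiveMaps E F := by
  intro X hX
  obtain ⟨n, u, rfl⟩ := exists_sum_ketBra hX
  rw [map_sum]
  exact LinearMap.isPositive_sum _ fun i _ => h _

/-- Polarization passes from `ηη*` to all `ηζ*`, and these span the operators. -/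
theorem linearMap_ext_ketBra {V : Type*} [AddCommGroup V] [Module ℂ V]
    {χ : (E →ₗ[ℂ] E) →ₗ[ℂ] V} (h : ∀ η, χ (ketBra η η) = 0) : χ = 0 := by
  have h' : ∀ η ζ, χ (ketBra η ζ) = 0 := by
    intro η ζ
    refine eq_zero_of_diagonal (fun ζ η => χ (ketBra η ζ)) h ?_ ζ η
    intro x y c
    simp only [ketBra_add_left, ketBra_add_right, ketBra_smul_left, ketBra_smul_right, map_add,
      map_smul]
    module
  ext X : 1
  have hX : X = ∑ i, ketBra (X (stdOrthonormalBasis ℂ E i)) (stdOrthonormalBasis ℂ E i) := by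
    ext z
    conv_lhs => rw [← (stdOrthonormalBasis ℂ E).sum_repr z]
    simp [ketBra_apply, OrthonormalBasis.repr_apply_apply]
  rw [hX, map_sum]
  simp [h']

/-- Polarized form of the symmetry of `ψ(ηη*)`. Unlike positivity, this property survives the
subtraction `ψ - cφ` with real `c`. -/
theorem positiveMaps_adjoint {ψ : (E →ₗ[ℂ] E) →ₗ[ℂ] (F →ₗ[ℂ] F)} (hψ : ψ ∈ positiveMaps E F)
    (η ζ : E) (h k : F) : ⟪ψ (ketBra ζ η) h, k⟫_ℂ = ⟪h, ψ (ketBra η ζ) k⟫_ℂ := by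
  rw [← sub_eq_zero]
  refine eq_zero_of_diagonal
    (fun ζ η => ⟪ψ (ketBra ζ η) h, k⟫_ℂ - ⟪h, ψ (ketBra η ζ) k⟫_ℂ) ?_ ?_ ζ η
  · intro x
    exact sub_eq_zero.mpr ((hψ _ (isPositive_ketBra x)).isSymmetric h k)
  · intro x y c
    simp only [ketBra_add_left, ketBra_add_right, ketBra_smul_left, ketBra_smul_right, map_add,
      map_smul, LinearMap.add_apply, LinearMap.smul_apply, inner_add_left, inner_add_right,
      inner_smul_left, inner_smul_right, Complex.conj_conj, smul_eq_mul]
    ring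

/-- In the polarization identity, antilinearity exchanges the terms with `i` and `-i`. -/
theorem Conjugation.inner_conj_conj (J : Conjugation E) (x y : E) :
    ⟪J.conj x, J.conj y⟫_ℂ = ⟪y, x⟫_ℂ := by
  have h := inner_eq_sum_norm_sq_div_four (𝕜 := ℂ) (J.conj x) (J.conj y)
  have h' := inner_eq_sum_norm_sq_div_four (𝕜 := ℂ) x y
  have e1 : J.conj x - RCLike.I (K := ℂ) • J.conj y = J.conj (x + RCLike.I (K := ℂ) • y) := by
    simp [map_add, map_smulₛₗ, sub_eq_add_neg]
  have e2 : J.conj x + RCLike.I (K := ℂ) • J.conj y = J.conj (x - RCLike.I (K := ℂ) • y) := by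
    simp [map_smulₛₗ, sub_eq_add_neg]
  rw [e1, e2, ← map_add, ← map_sub, J.norm_conj, J.norm_conj, J.norm_conj, J.norm_conj] at h
  have h4 : starRingEnd ℂ 4 = 4 := Complex.conj_ofReal 4
  rw [h, ← inner_conj_symm y x, h']
  simp [h4]
  ring

theorem transpose_ketBra (JE : Conjugation E) (JF : Conjugation F) (x : F) (ξ : E) :
    transpose JE JF (ketBra x ξ) = ketBra (JE.conj ξ) (JF.conj x) := by
  ext z
  change JE.conj (LinearMap.adjoint (ketBra x ξ) (JF.conj z)) = _
  rw [adjoint_ketBra, ketBra_apply, ketBra_apply, map_smulₛₗ, inner_conj_symm]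
  conv_rhs => rw [← JF.conj_conj z, JF.inner_conj_conj]

/-- The conjugation on `h` cancels the transpose built into the pairing. -/
theorem pairing_ketBra (JF : Conjugation F) (ψ : (E →ₗ[ℂ] E) →ₗ[ℂ] (F →ₗ[ℂ] F)) (η : E) (h : F) :
    pairing JF ψ (ketBra η η ⊗ₜ ketBra (JF.conj h) (JF.conj h)) = ⟪h, ψ (ketBra η η) h⟫_ℂ := by
  change LinearMap.trace ℂ F (ψ (ketBra η η) * transpose JF JF _) = _
  rw [transpose_ketBra, JF.conj_conj, ← trace_ketBra]
  congr 1
  ext z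
  simp [ketBra_apply]

/-- A positive map is exposed if it is determined, up to a nonnegative factor and among positive
maps, by its zeros `φ(η η*) h = 0`. -/
theorem isExposedPositive_of_zeros (JF : Conjugation F) {φ : (E →ₗ[ℂ] E) →ₗ[ℂ] (F →ₗ[ℂ] F)}
    (hφ : φ ∈ positiveMaps E F)
    (huniq : ∀ ψ ∈ positiveMaps E F, (∀ η h, φ (ketBra η η) h = 0 → ψ (ketBra η η) h = 0) →
      ∃ c : ℝ, 0 ≤ c ∧ ψ = (c : ℂ) • φ) : IsExposedPositive JF φ := by
  refine ⟨hφ, ?_⟩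
  let S : Set ((E →ₗ[ℂ] E) ⊗[ℂ] (F →ₗ[ℂ] F)) :=
    {Z | ∃ η h, φ (ketBra η η) h = 0 ∧ Z = ketBra η η ⊗ₜ ketBra (JF.conj h) (JF.conj h)}
  -- A linearly independent set in a finite-dimensional space is finite, so its elements can be
  -- summed to a separable operator.
  obtain ⟨b, hbS, hspan, hb⟩ := exists_linearIndependent ℂ S
  have hfin : b.Finite := hb.setFinite
  let e := hfin.toFinset.equivFin
  have hmem : ∀ i, ∃ η h, φ (ketBra η η) h = 0 ∧
      ((e.symm i : hfin.toFinset) : (E →ₗ[ℂ] E) ⊗[ℂ] (F →ₗ[ℂ] F)) =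
        ketBra η η ⊗ₜ ketBra (JF.conj h) (JF.conj h) := fun i =>
    hbS (hfin.mem_toFinset.mp (e.symm i).2)
  choose η h hz heq using hmem
  refine ⟨∑ i, ketBra (η i) (η i) ⊗ₜ ketBra (JF.conj (h i)) (JF.conj (h i)),
    ⟨_, _, _, fun i => isPositive_ketBra _, fun i => isPositive_ketBra _, rfl⟩, ?_⟩
  ext ψ
  simp only [Set.mem_ofPred_eq, map_sum, pairing_ketBra]
  constructor
  · rintro ⟨c, hc, rfl⟩
    refine ⟨fun X hX => (hφ X hX).smul_of_nonneg (by exact_mod_cast hc), ?_⟩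
    simp [hz]
  · rintro ⟨hψ, hsum⟩
    refine huniq ψ hψ fun η' h' hz' => ?_
    have hnn : ∀ i ∈ Finset.univ, 0 ≤ ⟪h i, ψ (ketBra (η i) (η i)) (h i)⟫_ℂ := fun i _ =>
      (hψ _ (isPositive_ketBra _)).inner_nonneg_right _
    have hzero := (Finset.sum_eq_zero_iff_of_nonneg hnn).mp hsum
    have hb0 : ∀ Z ∈ b, pairing JF ψ Z = 0 := by
      intro Z hZ
      have h1 := heq (e ⟨Z, hfin.mem_toFinset.mpr hZ⟩)
      rw [Equiv.symm_apply_apply] at h1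
      change Z = _ at h1
      rw [h1, pairing_ketBra]
      exact hzero _ (Finset.mem_univ _)
    have hle : Submodule.span ℂ b ≤ LinearMap.ker (pairing JF ψ) :=
      Submodule.span_le.mpr hb0
    have hmem' : ketBra η' η' ⊗ₜ ketBra (JF.conj h') (JF.conj h') ∈ Submodule.span ℂ b := by
      rw [hspan]
      exact Submodule.subset_span ⟨η', h', hz', rfl⟩
    have := hle hmem'
    rw [LinearMap.mem_ker, pairing_ketBra] at this
    exact apply_eq_zero_of_inner_eq_zero (hψ _ (isPositive_ketBra _)) this

end Exposed

/-! ### Comparing coefficients of polynomials in complex variables and their conjugates. -/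

section Coefficients

variable {V : Type*} [AddCommGroup V] [Module ℂ V]

/-- Lagrange interpolation of a quartic at the nodes `0, ±1, ±2`. -/
theorem real_poly_coeff_eq_zero (p0 p1 p2 p3 p4 : V)
    (h : ∀ r : ℝ, p0 + (r : ℂ) • p1 + (r ^ 2 : ℂ) • p2 + (r ^ 3 : ℂ) • p3 + (r ^ 4 : ℂ) • p4 = 0) :
    p0 = 0 ∧ p1 = 0 ∧ p2 = 0 ∧ p3 = 0 ∧ p4 = 0 := by
  have h0 := h 0
  have h1 := h 1
  have h2 := h (-1)
  have h3 := h 2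
  have h4 := h (-2)
  push_cast at h0 h1 h2 h3 h4
  refine ⟨?_, ?_, ?_, ?_, ?_⟩
  · linear_combination (norm := module) h0
  · linear_combination (norm := module) (2 / 3 : ℂ) • h1 - (2 / 3 : ℂ) • h2 - (1 / 12 : ℂ) • h3 +
      (1 / 12 : ℂ) • h4
  · linear_combination (norm := module) (-(5 / 4) : ℂ) • h0 + (2 / 3 : ℂ) • h1 + (2 / 3 : ℂ) • h2
      - (1 / 24 : ℂ) • h3 - (1 / 24 : ℂ) • h4
  · linear_combination (norm := module) (-(1 / 6) : ℂ) • h1 + (1 / 6 : ℂ) • h2 + (1 / 12 : ℂ) • h3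
      - (1 / 12 : ℂ) • h4
  · linear_combination (norm := module) (1 / 4 : ℂ) • h0 - (1 / 6 : ℂ) • h1 - (1 / 6 : ℂ) • h2
      + (1 / 24 : ℂ) • h3 + (1 / 24 : ℂ) • h4

/-- A polynomial in `z` and `z̄` of degree at most two in each that vanishes identically has zero
coefficients. -/
theorem conj_poly_coeff_eq_zero (v : Fin 3 → Fin 3 → V)
    (h : ∀ z : ℂ, ∑ i : Fin 3, ∑ j : Fin 3, (z ^ (i : ℕ) * starRingEnd ℂ z ^ (j : ℕ)) • v i j = 0) (i j : Fin 3) :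
    v i j = 0 := by
  -- Replacing `z` by `rz` with `r` real separates the components of fixed total degree.
  have key : ∀ z : ℂ, v 0 0 = 0 ∧ z • v 1 0 + starRingEnd ℂ z • v 0 1 = 0 ∧
      z ^ 2 • v 2 0 + (z * starRingEnd ℂ z) • v 1 1 + (starRingEnd ℂ z ^ 2) • v 0 2 = 0 ∧
      (z ^ 2 * starRingEnd ℂ z) • v 2 1 + (z * starRingEnd ℂ z ^ 2) • v 1 2 = 0 ∧
      (z ^ 2 * starRingEnd ℂ z ^ 2) • v 2 2 = 0 := by
    intro z
    refine real_poly_coeff_eq_zero _ _ _ _ _ fun r => ?_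
    rw [← h (r * z)]
    simp only [Fin.sum_univ_three, map_mul, Complex.conj_ofReal, Fin.val_zero, Fin.val_one,
      Fin.val_two]
    module
  -- Within each total degree, the points `1`, `i` and `1 + i` suffice; only degree two needs the
  -- third.
  obtain ⟨h00, a1, a2, a3, h22⟩ := key 1
  obtain ⟨-, b1, b2, b3, -⟩ := key Complex.I
  obtain ⟨-, -, c2, -, -⟩ := key (1 + Complex.I)
  have hs : (1 + Complex.I) ^ 2 = 2 * Complex.I := by linear_combination Complex.I_sq
  have hs' : (1 - Complex.I) ^ 2 = -(2 * Complex.I) := by linear_combination Complex.I_sq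
  have hs'' : (1 + Complex.I) * (1 - Complex.I) = 2 := by linear_combination -Complex.I_sq
  simp only [map_one, map_add, Complex.conj_I, ← sub_eq_add_neg, hs, hs', hs'', neg_sq,
    Complex.I_sq, mul_neg, Complex.I_mul_I, neg_neg, one_pow, one_mul, one_smul, neg_mul] at *
  have h11 : v 1 1 = 0 := by linear_combination (norm := module) (1 / 2 : ℂ) • a2 + (1 / 2 : ℂ) • b2
  have two : ∀ x y : V, x + y = 0 → Complex.I • x - Complex.I • y = 0 → x = 0 ∧ y = 0 := by
    intro x y h1 h2
    rw [← smul_sub, smul_eq_zero, or_iff_right Complex.I_ne_zero] at h2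
    constructor
    · linear_combination (norm := module) (1 / 2 : ℂ) • h1 + (1 / 2 : ℂ) • h2
    · linear_combination (norm := module) (1 / 2 : ℂ) • h1 - (1 / 2 : ℂ) • h2
  rw [h11] at a2 c2
  obtain ⟨h10, h01⟩ := two _ _ a1 (by rw [← b1]; module)
  obtain ⟨h20, h02⟩ := two (v 2 0) (v 0 2) (by rw [← a2]; module)
    (by linear_combination (norm := module) (1 / 2 : ℂ) • c2)
  obtain ⟨h12, h21⟩ := two (v 1 2) (v 2 1) (by rw [← a3]; module)
    (by linear_combination (norm := module) (-1 : ℂ) • b3)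
  fin_cases i <;> fin_cases j <;> assumption

theorem conj_poly_coeff_eq_zero₂ (v : Fin 3 → Fin 3 → Fin 3 → Fin 3 → V)
    (h : ∀ z w : ℂ, ∑ i : Fin 3, ∑ j : Fin 3, (z ^ (i : ℕ) * starRingEnd ℂ z ^ (j : ℕ)) •
      ∑ k : Fin 3, ∑ l : Fin 3, (w ^ (k : ℕ) * starRingEnd ℂ w ^ (l : ℕ)) • v i j k l = 0) (i j k l : Fin 3) :
    v i j k l = 0 :=
  conj_poly_coeff_eq_zero (v i j)
    (fun w => conj_poly_coeff_eq_zero _ (fun z => h z w) i j) k l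

end Coefficients

end Merging

namespace Merging

/-! ### The common zeros force a hermiticity preserving map to vanish. -/

section Uniqueness

/-- Components of a polynomial identity in `z, z̄, w, w̄` which arises from
`χ(η η*) h = 0` with `η = z p + w q + e` and `h = -z α - ν w̄ β + (|z|² N + |w|² M) f`. -/
theorem bidegree_components {V : Type*} [AddCommGroup V] [Module ℂ V]
    (pp qq ee pq qp pe ep qe eq : V →ₗ[ℂ] V) (α β f : V) (N M ν : ℂ)
    (h : ∀ z w : ℂ, ((z * starRingEnd ℂ z) • pp + (w * starRingEnd ℂ w) • qq + ee
      + (z * starRingEnd ℂ w) • pq + (w * starRingEnd ℂ z) • qp + z • pe + starRingEnd ℂ z • ep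
      + w • qe + starRingEnd ℂ w • eq)
      (-(z • α) - (ν * starRingEnd ℂ w) • β
        + (z * starRingEnd ℂ z * N + w * starRingEnd ℂ w * M) • f) = 0) :
    (ee α = 0 ∧ ν • ee β = 0) ∧ (ep α = N • ee f ∧ ν • ep β = 0 ∧ N • ep f = 0) ∧
      (qe α = 0 ∧ ν • qe β = M • ee f ∧ M • qe f = 0) ∧
      (qp α = N • qe f ∧ ν • qp β = M • ep f ∧ N • qp f = 0) ∧
      (pp α = N • pe f ∧ ν • pp β = N • eq f) ∧
      (qq α = M • pe f ∧ ν • qq β = M • eq f) ∧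
      (N • pp f = 0 ∧ M • qq f = 0 ∧ M • pp f + N • qq f = 0) := by
  -- The entry with indices `i j k l` is the coefficient of `zⁱ z̄ʲ wᵏ w̄ˡ` in the expanded
  -- identity.
  have key := conj_poly_coeff_eq_zero₂
    (![![![![0, -(ν • ee β), -(ν • eq β)], ![0, M • ee f + -(ν • qe β), -(ν • qq β) + M • eq f], ![0, M • qe f, M • qq f]],
          ![![0, -(ν • ep β), 0], ![0, -(ν • qp β) + M • ep f, 0], ![0, M • qp f, 0]],
          ![![0, 0, 0], ![0, 0, 0], ![0, 0, 0]]],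
        ![![![-ee α, -(ν • pe β) + -eq α, -(ν • pq β)], ![-qe α, -qq α + M • pe f, M • pq f], ![0, 0, 0]],
          ![![N • ee f + -ep α, -(ν • pp β) + N • eq f, 0], ![-qp α + N • qe f, M • pp f + N • qq f, 0], ![0, 0, 0]],
          ![![N • ep f, 0, 0], ![N • qp f, 0, 0], ![0, 0, 0]]],
        ![![![-pe α, -pq α, 0], ![0, 0, 0], ![0, 0, 0]],
          ![![-pp α + N • pe f, N • pq f, 0], ![0, 0, 0], ![0, 0, 0]],
          ![![N • pp f, 0, 0], ![0, 0, 0], ![0, 0, 0]]]]) ?_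
  · refine ⟨⟨neg_eq_zero.mp (key 1 0 0 0), neg_eq_zero.mp (key 0 0 0 1)⟩,
      ⟨?_, neg_eq_zero.mp (key 0 1 0 1), key 1 2 0 0⟩,
      ⟨neg_eq_zero.mp (key 1 0 1 0), ?_, key 0 0 2 1⟩, ⟨?_, ?_, key 1 2 1 0⟩, ⟨?_, ?_⟩, ⟨?_, ?_⟩,
      key 2 2 0 0, key 0 0 2 2, key 1 1 1 1⟩
    · exact (neg_add_eq_zero.mp ((add_comm _ _).trans (key 1 1 0 0)))
    · exact (neg_add_eq_zero.mp ((add_comm _ _).trans (key 0 0 1 1)))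
    · exact neg_add_eq_zero.mp (key 1 1 1 0)
    · exact neg_add_eq_zero.mp (key 0 1 1 1)
    · exact neg_add_eq_zero.mp (key 2 1 0 0)
    · exact neg_add_eq_zero.mp (key 1 1 0 1)
    · exact neg_add_eq_zero.mp (key 1 0 1 1)
    · exact neg_add_eq_zero.mp (key 0 0 1 2)
  · intro z w
    refine Eq.trans ?_ (h z w)
    simp only [Fin.sum_univ_three, Matrix.cons_val, Fin.val_zero, Fin.val_one, Fin.val_two,
      LinearMap.add_apply, LinearMap.smul_apply, map_add, map_sub, map_neg, map_smul, smul_zero, add_zero, zero_add]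
    module

/-- An additive map that vanishes off the kernel of a nonzero additive map is zero. -/
theorem eq_zero_of_forall_ne {K G V : Type*} [AddCommGroup K] [AddCommGroup G] [AddCommGroup V]
    (A : K → G) (hA : ∀ x y, A (x + y) = A x + A y) (hne : ∃ x, A x ≠ 0) (L : K → V)
    (hL : ∀ x y, L (x + y) = L x + L y) (h : ∀ x, A x ≠ 0 → L x = 0) (x : K) : L x = 0 := by
  obtain ⟨y, hy⟩ := hne
  by_cases hx : A x = 0
  · have := h (x + y) (by rwa [hA, hx, zero_add])
    rwa [hL, h y hy, add_zero] at this
  · exact h x hx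

variable {E F K₁ K₂ : Type*}
  [NormedAddCommGroup E] [InnerProductSpace ℂ E] [FiniteDimensional ℂ E]
  [NormedAddCommGroup F] [InnerProductSpace ℂ F] [FiniteDimensional ℂ F]
  [AddCommGroup K₁] [Module ℂ K₁] [AddCommGroup K₂] [Module ℂ K₂]

theorem linearMap_eq_zero_of_orthogonal (T : F →ₗ[ℂ] F) (S : Set F) (h : ∀ s ∈ S, T s = 0)
    (h' : ∀ x, (∀ s ∈ S, ⟪s, x⟫_ℂ = 0) → T x = 0) : T = 0 := by
  ext x
  have hS : Submodule.span ℂ S ≤ LinearMap.ker T := Submodule.span_le.mpr h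
  have hx : T ((Submodule.span ℂ S)ᗮ.starProjection x) = 0 := by
    refine h' _ fun s hs => ?_
    exact (Submodule.mem_orthogonal _ _).mp (Submodule.starProjection_apply_mem _ x) s
      (Submodule.subset_span hs)
  have hx' : T ((Submodule.span ℂ S).starProjection x) = 0 :=
    hS (Submodule.starProjection_apply_mem _ x)
  rw [← (Submodule.span ℂ S).starProjection_add_starProjection_orthogonal x, map_add, hx, hx',
    add_zero, LinearMap.zero_apply]

/-- A hermiticity preserving map which vanishes on the zeros of a block map, and whose last
diagonal entry at the last matrix unit is zero, vanishes. -/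
theorem eq_zero_of_common_zeros (χ : (E →ₗ[ℂ] E) →ₗ[ℂ] (F →ₗ[ℂ] F))
    (hχ : ∀ η ζ h k, ⟪χ (ketBra ζ η) h, k⟫_ℂ = ⟪h, χ (ketBra η ζ) k⟫_ℂ)
    (ι₁ : K₁ →ₗ[ℂ] E) (ι₂ : K₂ →ₗ[ℂ] E) (e : E)
    (hspan : ∀ η, ∃ η₁ η₂, ∃ t : ℂ, η = ι₁ η₁ + ι₂ η₂ + t • e)
    (a : K₁ →ₗ[ℂ] F) (b : K₂ →ₗ⋆[ℂ] F) (f : F) (ha : ∃ η, a η ≠ 0) (hb : ∃ η, b η ≠ 0)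
    {ν : ℝ} (hν : 0 < ν)
    (hgen : ∀ η₁ η₂, χ (ketBra (ι₁ η₁ + ι₂ η₂ + e) (ι₁ η₁ + ι₂ η₂ + e))
      (-a η₁ - (ν : ℂ) • b η₂ + ((‖a η₁‖ ^ 2 + ν * ‖b η₂‖ ^ 2 : ℝ) : ℂ) • f) = 0)
    (hort : ∀ η h, (∀ η₁, ⟪a η₁, h⟫_ℂ = 0) → (∀ η₂, ⟪b η₂, h⟫_ℂ = 0) → ⟪f, h⟫_ℂ = 0 →
      χ (ketBra η η) h = 0)
    (hort₁ : ∀ η₁ h, ⟪a η₁, h⟫_ℂ = 0 → (∀ η₂, ⟪b η₂, h⟫_ℂ = 0) → ⟪f, h⟫_ℂ = 0 →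
      χ (ketBra (ι₁ η₁) (ι₁ η₁)) h = 0)
    (hort₂ : ∀ η₂ h, (∀ η₁, ⟪a η₁, h⟫_ℂ = 0) → ⟪b η₂, h⟫_ℂ = 0 → ⟪f, h⟫_ℂ = 0 →
      χ (ketBra (ι₂ η₂) (ι₂ η₂)) h = 0)
    (hee : ⟪f, χ (ketBra e e) f⟫_ℂ = 0) : χ = 0 := by
  have hν0 : (ν : ℂ) ≠ 0 := by exact_mod_cast hν.ne'
  have comp := fun η₁ η₂ => bidegree_components
    (χ (ketBra (ι₁ η₁) (ι₁ η₁))) (χ (ketBra (ι₂ η₂) (ι₂ η₂))) (χ (ketBra e e))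
    (χ (ketBra (ι₁ η₁) (ι₂ η₂))) (χ (ketBra (ι₂ η₂) (ι₁ η₁)))
    (χ (ketBra (ι₁ η₁) e)) (χ (ketBra e (ι₁ η₁)))
    (χ (ketBra (ι₂ η₂) e)) (χ (ketBra e (ι₂ η₂))) (a η₁) (b η₂) f
    ((‖a η₁‖ ^ 2 : ℝ) : ℂ) ((ν * ‖b η₂‖ ^ 2 : ℝ) : ℂ) (ν : ℂ) (by
      -- The generic zeros are stable under scaling `η₁` by `z` and `η₂` by `w`: `a` contributes
      -- `z`, the antilinear `b` contributes `w̄`, and the squared norms `z z̄` and `w w̄`.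
      intro z w
      rw [← hgen (z • η₁) (w • η₂)]
      congr 1
      · simp only [ketBra_add_left, ketBra_add_right, ketBra_smul_left, ketBra_smul_right, map_add,
          map_smul]
        module
      · simp only [map_smul, map_smulₛₗ, norm_smul, mul_pow, RCLike.norm_conj]
        push_cast
        simp only [← Complex.mul_conj']
        module)
  have adj : ∀ η ζ, χ (ketBra η ζ) = 0 → χ (ketBra ζ η) = 0 := by
    intro η ζ h
    ext x
    refine ext_inner_right ℂ fun y => ?_
    rw [hχ, h]
    simp
  have hort' : ∀ ζ η h, (∀ η₁, ⟪a η₁, h⟫_ℂ = 0) → (∀ η₂, ⟪b η₂, h⟫_ℂ = 0) → ⟪f, h⟫_ℂ = 0 →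
      χ (ketBra η ζ) h = 0 := by
    intro ζ η h h1 h2 h3
    refine eq_zero_of_diagonal (fun ζ η => χ (ketBra η ζ) h) (fun x => hort x h h1 h2 h3) ?_ ζ η
    intro x y c
    simp only [ketBra_add_left, ketBra_add_right, ketBra_smul_left, ketBra_smul_right, map_add,
      map_smul, LinearMap.add_apply, LinearMap.smul_apply]
    module
  have kill : ∀ η ζ, (∀ η₁, χ (ketBra η ζ) (a η₁) = 0) → (∀ η₂, χ (ketBra η ζ) (b η₂) = 0) →
      χ (ketBra η ζ) f = 0 → χ (ketBra η ζ) = 0 := by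
    intro η ζ h1 h2 h3
    refine linearMap_eq_zero_of_orthogonal _ (Set.range a ∪ Set.range b ∪ {f}) ?_ ?_
    · rintro s ((⟨x, rfl⟩ | ⟨x, rfl⟩) | rfl)
      exacts [h1 x, h2 x, h3]
    · intro x hx
      exact hort' _ _ _ (fun y => hx _ (Or.inl (Or.inl ⟨y, rfl⟩)))
        (fun y => hx _ (Or.inl (Or.inr ⟨y, rfl⟩))) (hx _ (Or.inr rfl))
  have ee_a : ∀ η₁, χ (ketBra e e) (a η₁) = 0 := fun η₁ => (comp η₁ 0).1.1
  have ee_b : ∀ η₂, χ (ketBra e e) (b η₂) = 0 := fun η₂ =>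
    (smul_eq_zero.mp (comp 0 η₂).1.2).resolve_left hν0
  have ee_f : χ (ketBra e e) f = 0 := by
    -- The vector `χ(ee*)f` is orthogonal to `f` and the ranges of `a` and `b`, so `χ(ee*)` kills
    -- it; by symmetry its squared norm is zero.
    rw [← inner_self_eq_zero (𝕜 := ℂ), ← hχ, hort, inner_zero_left]
    · intro η₁
      rw [← hχ, ee_a, inner_zero_left]
    · intro η₂
      rw [← hχ, ee_b, inner_zero_left]
    · exact hee
  have hee0 : χ (ketBra e e) = 0 := kill e e ee_a ee_b ee_f
  have norm_ne : ∀ η₁, a η₁ ≠ 0 → ((‖a η₁‖ ^ 2 : ℝ) : ℂ) ≠ 0 := by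
    intro η₁ h
    exact_mod_cast pow_ne_zero 2 (norm_ne_zero_iff.mpr h)
  have norm_ne' : ∀ η₂, b η₂ ≠ 0 → ((ν * ‖b η₂‖ ^ 2 : ℝ) : ℂ) ≠ 0 := by
    intro η₁ h
    exact_mod_cast mul_ne_zero hν.ne' (pow_ne_zero 2 (norm_ne_zero_iff.mpr h))
  have ep : ∀ η₁, χ (ketBra e (ι₁ η₁)) = 0 := by
    intro η₁
    refine kill _ _ (fun η₁' => ?_) (fun η₂ => ?_) ?_
    -- The coefficients only control equal arguments. The expression is antilinear in `η` and linear
    -- in `η'`, so polarization applies; with `ketBra (ι₁ η) e` it would be bilinear, and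
    -- polarization would not.
    · refine eq_zero_of_diagonal (fun η η' => χ (ketBra e (ι₁ η)) (a η')) (fun x => ?_) ?_ η₁ η₁'
      · rw [(comp x 0).2.1.1, ee_f, smul_zero]
      · intro x y c
        simp only [ketBra_add_right, ketBra_smul_right, map_add,
          map_smul, LinearMap.add_apply, LinearMap.smul_apply]
        module
    · exact (smul_eq_zero.mp (comp η₁ η₂).2.1.2.1).resolve_left hν0
    -- The coefficient carries the factor `‖a η‖²`, which can be cancelled only off the kernel of
    -- `a`.
    · refine eq_zero_of_forall_ne a (map_add a) ha (fun η => χ (ketBra e (ι₁ η)) f) ?_ ?_ η₁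
      · intro x y
        simp only [ketBra_add_right, map_add, LinearMap.add_apply]
      · intro x hx
        exact (smul_eq_zero.mp (comp x 0).2.1.2.2).resolve_left (norm_ne x hx)
  have qe : ∀ η₂, χ (ketBra (ι₂ η₂) e) = 0 := by
    intro η₂
    refine kill _ _ (fun η₁ => ?_) (fun η₂' => ?_) ?_
    · exact (comp η₁ η₂).2.2.1.1
    · refine eq_zero_of_diagonal (fun η' η => χ (ketBra (ι₂ η) e) (b η')) (fun x => ?_) ?_ η₂' η₂
      · have := (comp 0 x).2.2.1.2.1
        rw [ee_f, smul_zero] at this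
        exact (smul_eq_zero.mp this).resolve_left hν0
      · intro x y c
        simp only [ketBra_add_left, ketBra_smul_left, map_add, map_smulₛₗ,
          RingHom.id_apply, LinearMap.add_apply, LinearMap.smul_apply]
        module
    · refine eq_zero_of_forall_ne b (map_add b) hb (fun η => χ (ketBra (ι₂ η) e) f) ?_ ?_ η₂
      · intro x y
        simp only [ketBra_add_left, map_add, LinearMap.add_apply]
      · intro x hx
        exact (smul_eq_zero.mp (comp 0 x).2.2.1.2.2).resolve_left (norm_ne' x hx)
  -- The opposite off-diagonal blocks follow by taking adjoints.
  have pe : ∀ η₁, χ (ketBra (ι₁ η₁) e) = 0 := fun η₁ => adj _ _ (ep η₁)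
  have eq : ∀ η₂, χ (ketBra e (ι₂ η₂)) = 0 := fun η₂ => adj _ _ (qe η₂)
  have qp : ∀ η₁ η₂, χ (ketBra (ι₂ η₂) (ι₁ η₁)) = 0 := by
    intro η₁ η₂
    refine kill _ _ (fun η₁' => ?_) (fun η₂' => ?_) ?_
    · refine eq_zero_of_diagonal (fun η η' => χ (ketBra (ι₂ η₂) (ι₁ η)) (a η')) (fun x => ?_) ?_
        η₁ η₁'
      · rw [(comp x η₂).2.2.2.1.1, qe, LinearMap.zero_apply, smul_zero]
      · intro x y c
        simp only [ketBra_add_right, ketBra_smul_right, map_add,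
          map_smul, LinearMap.add_apply, LinearMap.smul_apply]
        module
    · refine eq_zero_of_diagonal (fun η' η => χ (ketBra (ι₂ η) (ι₁ η₁)) (b η')) (fun x => ?_) ?_
        η₂' η₂
      · have := (comp η₁ x).2.2.2.1.2.1
        rw [ep, LinearMap.zero_apply, smul_zero] at this
        exact (smul_eq_zero.mp this).resolve_left hν0
      · intro x y c
        simp only [ketBra_add_left, ketBra_smul_left, map_add, map_smulₛₗ,
          RingHom.id_apply, LinearMap.add_apply, LinearMap.smul_apply]
        module
    · refine eq_zero_of_forall_ne a (map_add a) ha (fun η => χ (ketBra (ι₂ η₂) (ι₁ η)) f) ?_ ?_ η₁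
      · intro x y
        simp only [ketBra_add_right, map_add, LinearMap.add_apply]
      · intro x hx
        exact (smul_eq_zero.mp (comp x η₂).2.2.2.1.2.2).resolve_left (norm_ne x hx)
  have pq : ∀ η₁ η₂, χ (ketBra (ι₁ η₁) (ι₂ η₂)) = 0 := fun η₁ η₂ => adj _ _ (qp η₁ η₂)
  have pp_f : ∀ η₁, χ (ketBra (ι₁ η₁) (ι₁ η₁)) f = 0 := by
    intro η₁
    -- The `z²z̄²` coefficient settles the case `a η₁ ≠ 0`. Otherwise the `zz̄ww̄` coefficient is
    -- used, with some `b η₂ ≠ 0`.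
    by_cases h : a η₁ = 0
    · obtain ⟨η₂, h'⟩ := hb
      have := (comp η₁ η₂).2.2.2.2.2.2.2.2
      simp only [h, norm_zero, ne_eq, OfNat.ofNat_ne_zero, not_false_eq_true, zero_pow,
        Complex.ofReal_zero, zero_smul, add_zero] at this
      exact (smul_eq_zero.mp this).resolve_left (norm_ne' η₂ h')
    · exact (smul_eq_zero.mp (comp η₁ 0).2.2.2.2.2.2.1).resolve_left (norm_ne η₁ h)
  have qq_f : ∀ η₂, χ (ketBra (ι₂ η₂) (ι₂ η₂)) f = 0 := by
    intro η₂
    obtain ⟨η₁, h⟩ := ha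
    have := (comp η₁ η₂).2.2.2.2.2.2.2.2
    rw [pp_f, smul_zero, zero_add] at this
    exact (smul_eq_zero.mp this).resolve_left (norm_ne η₁ h)
  have pp : ∀ η₁, χ (ketBra (ι₁ η₁) (ι₁ η₁)) = 0 := by
    intro η₁
    -- Here `η₁` occurs twice in the operator, so `a η₁` cannot be decoupled by polarization. The
    -- richer zeros `hort₁`, which ask for orthogonality to the single vector `a η₁`, compensate.
    refine linearMap_eq_zero_of_orthogonal _ ({a η₁} ∪ Set.range b ∪ {f}) ?_ ?_
    · rintro s ((rfl | ⟨x, rfl⟩) | rfl)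
      · rw [(comp η₁ 0).2.2.2.2.1.1, pe, LinearMap.zero_apply, smul_zero]
      · have := (comp η₁ x).2.2.2.2.1.2
        rw [eq, LinearMap.zero_apply, smul_zero] at this
        exact (smul_eq_zero.mp this).resolve_left hν0
      · exact pp_f η₁
    · intro x hx
      exact hort₁ _ _ (hx _ (Or.inl (Or.inl rfl))) (fun y => hx _ (Or.inl (Or.inr ⟨y, rfl⟩)))
        (hx _ (Or.inr rfl))
  have qq : ∀ η₂, χ (ketBra (ι₂ η₂) (ι₂ η₂)) = 0 := by
    intro η₂
    refine linearMap_eq_zero_of_orthogonal _ (Set.range a ∪ {b η₂} ∪ {f}) ?_ ?_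
    · rintro s ((⟨x, rfl⟩ | rfl) | rfl)
      · rw [(comp x η₂).2.2.2.2.2.1.1, pe, LinearMap.zero_apply, smul_zero]
      · have := (comp 0 η₂).2.2.2.2.2.1.2
        rw [eq, LinearMap.zero_apply, smul_zero] at this
        exact (smul_eq_zero.mp this).resolve_left hν0
      · exact qq_f η₂
    · intro x hx
      exact hort₂ _ _ (fun y => hx _ (Or.inl (Or.inl ⟨y, rfl⟩))) (hx _ (Or.inl (Or.inr rfl)))
        (hx _ (Or.inr rfl))
  refine linearMap_ext_ketBra fun η => ?_
  obtain ⟨η₁, η₂, t, rfl⟩ := hspan η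
  simp only [ketBra_add_left, ketBra_add_right, ketBra_smul_left, ketBra_smul_right, map_add,
    map_smul, pp, qq, hee0, pq, qp, pe, ep, qe, eq, smul_zero, add_zero]

end Uniqueness

end Merging

namespace Merging

/-! ### Coordinates on the direct sum and projections. -/

section Coordinates

variable {E₁ E₂ : Type*}
  [NormedAddCommGroup E₁] [InnerProductSpace ℂ E₁] [NormedAddCommGroup E₂] [InnerProductSpace ℂ E₂]

theorem pr₁_inj₁ (x : E₁) : pr₁ E₁ E₂ (inj₁ E₁ E₂ x) = x := rfl
theorem pr₂_inj₁ (x : E₁) : pr₂ E₁ E₂ (inj₁ E₁ E₂ x) = 0 := rfl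
theorem pr₃_inj₁ (x : E₁) : pr₃ E₁ E₂ (inj₁ E₁ E₂ x) = 0 := rfl
theorem pr₁_inj₂ (x : E₂) : pr₁ E₁ E₂ (inj₂ E₁ E₂ x) = 0 := rfl
theorem pr₂_inj₂ (x : E₂) : pr₂ E₁ E₂ (inj₂ E₁ E₂ x) = x := rfl
theorem pr₃_inj₂ (x : E₂) : pr₃ E₁ E₂ (inj₂ E₁ E₂ x) = 0 := rfl
theorem pr₁_inj₃ (x : ℂ) : pr₁ E₁ E₂ (inj₃ E₁ E₂ x) = 0 := rfl
theorem pr₂_inj₃ (x : ℂ) : pr₂ E₁ E₂ (inj₃ E₁ E₂ x) = 0 := rfl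
theorem pr₃_inj₃ (x : ℂ) : pr₃ E₁ E₂ (inj₃ E₁ E₂ x) = x := rfl

theorem inner_sum₃ (h k : Sum₃ E₁ E₂) : ⟪h, k⟫_ℂ =
    ⟪pr₁ E₁ E₂ h, pr₁ E₁ E₂ k⟫_ℂ + ⟪pr₂ E₁ E₂ h, pr₂ E₁ E₂ k⟫_ℂ +
      starRingEnd ℂ (pr₃ E₁ E₂ h) * pr₃ E₁ E₂ k := by
  rw [WithLp.prod_inner_apply, WithLp.prod_inner_apply, add_assoc, mul_comm]
  rfl

theorem inner_inj₁ (x : E₁) (h : Sum₃ E₁ E₂) : ⟪inj₁ E₁ E₂ x, h⟫_ℂ = ⟪x, pr₁ E₁ E₂ h⟫_ℂ := by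
  rw [inner_sum₃]
  simp [pr₁_inj₁, pr₂_inj₁, pr₃_inj₁]

theorem inner_inj₂ (x : E₂) (h : Sum₃ E₁ E₂) : ⟪inj₂ E₁ E₂ x, h⟫_ℂ = ⟪x, pr₂ E₁ E₂ h⟫_ℂ := by
  rw [inner_sum₃]
  simp [pr₁_inj₂, pr₂_inj₂, pr₃_inj₂]

theorem inner_inj₃ (x : ℂ) (h : Sum₃ E₁ E₂) :
    ⟪inj₃ E₁ E₂ x, h⟫_ℂ = starRingEnd ℂ x * pr₃ E₁ E₂ h := by
  rw [inner_sum₃]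
  simp [pr₁_inj₃, pr₂_inj₃, pr₃_inj₃]

theorem norm_inj₁ (x : E₁) : ‖inj₁ E₁ E₂ x‖ = ‖x‖ := by
  rw [@norm_eq_sqrt_re_inner ℂ, @norm_eq_sqrt_re_inner ℂ _ _ _ _ x, inner_inj₁, pr₁_inj₁]

theorem norm_inj₂ (x : E₂) : ‖inj₂ E₁ E₂ x‖ = ‖x‖ := by
  rw [@norm_eq_sqrt_re_inner ℂ, @norm_eq_sqrt_re_inner ℂ _ _ _ _ x, inner_inj₂, pr₂_inj₂]

theorem sum₃_decomposition (h : Sum₃ E₁ E₂) :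
    h = inj₁ E₁ E₂ (pr₁ E₁ E₂ h) + inj₂ E₁ E₂ (pr₂ E₁ E₂ h) + inj₃ E₁ E₂ (pr₃ E₁ E₂ h) := by
  refine ext_inner_left ℂ fun k => ?_
  rw [inner_add_right, inner_add_right, ← inner_conj_symm k (inj₁ _ _ _),
    ← inner_conj_symm k (inj₂ _ _ _), ← inner_conj_symm k (inj₃ _ _ _), inner_inj₁, inner_inj₂,
    inner_inj₃, inner_conj_symm, inner_conj_symm, inner_sum₃, map_mul, Complex.conj_conj, mul_comm]

theorem ketBra_inj₁ {G : Type*} [NormedAddCommGroup G] [InnerProductSpace ℂ G] (x : G)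
    (η : Sum₃ E₁ E₂) : ketBra x η ∘ₗ inj₁ E₁ E₂ = ketBra x (pr₁ E₁ E₂ η) := by
  ext z
  rw [LinearMap.comp_apply, ketBra_apply, ketBra_apply, ← inner_conj_symm η, inner_inj₁,
    inner_conj_symm]

theorem ketBra_inj₂ {G : Type*} [NormedAddCommGroup G] [InnerProductSpace ℂ G] (x : G)
    (η : Sum₃ E₁ E₂) : ketBra x η ∘ₗ inj₂ E₁ E₂ = ketBra x (pr₂ E₁ E₂ η) := by
  ext z
  rw [LinearMap.comp_apply, ketBra_apply, ketBra_apply, ← inner_conj_symm η, inner_inj₂,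
    inner_conj_symm]

theorem ketBra_inj₃ {G : Type*} [NormedAddCommGroup G] [InnerProductSpace ℂ G] (x : G)
    (η : Sum₃ E₁ E₂) : ketBra x η ∘ₗ inj₃ E₁ E₂ = ketBra x (pr₃ E₁ E₂ η) := by
  refine LinearMap.ext fun z => ?_
  rw [LinearMap.comp_apply, ketBra_apply, ketBra_apply, ← inner_conj_symm η, inner_inj₃,
    map_mul, Complex.conj_conj, RCLike.inner_apply]

theorem comp_ketBra {G G' E : Type*} [NormedAddCommGroup G] [InnerProductSpace ℂ G]
    [NormedAddCommGroup G'] [InnerProductSpace ℂ G'] [NormedAddCommGroup E] [InnerProductSpace ℂ E]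
    (A : G →ₗ[ℂ] G') (x : G) (ξ : E) : A ∘ₗ ketBra x ξ = ketBra (A x) ξ := by
  ext z
  simp [ketBra_apply]

theorem ketBra_comp_adjoint {G : Type*} [NormedAddCommGroup G] [InnerProductSpace ℂ G]
    [FiniteDimensional ℂ E₁] [FiniteDimensional ℂ E₂]
    (A : E₁ →ₗ[ℂ] E₂) (x : G) (ξ : E₁) : ketBra x ξ ∘ₗ LinearMap.adjoint A = ketBra x (A ξ) := by
  ext z
  simp [ketBra_apply, LinearMap.adjoint_inner_right]

theorem ofBlocks_apply
    (Y₁₁ : E₁ →ₗ[ℂ] E₁) (Y₁₂ : E₂ →ₗ[ℂ] E₁) (Y₁₃ : ℂ →ₗ[ℂ] E₁)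
    (Y₂₁ : E₁ →ₗ[ℂ] E₂) (Y₂₂ : E₂ →ₗ[ℂ] E₂) (Y₂₃ : ℂ →ₗ[ℂ] E₂)
    (Y₃₁ : E₁ →ₗ[ℂ] ℂ) (Y₃₂ : E₂ →ₗ[ℂ] ℂ) (Y₃₃ : ℂ →ₗ[ℂ] ℂ) (h : Sum₃ E₁ E₂) :
    ofBlocks Y₁₁ Y₁₂ Y₁₃ Y₂₁ Y₂₂ Y₂₃ Y₃₁ Y₃₂ Y₃₃ h =
      inj₁ E₁ E₂ (Y₁₁ (pr₁ E₁ E₂ h) + Y₁₂ (pr₂ E₁ E₂ h) + Y₁₃ (pr₃ E₁ E₂ h)) +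
      inj₂ E₁ E₂ (Y₂₁ (pr₁ E₁ E₂ h) + Y₂₂ (pr₂ E₁ E₂ h) + Y₂₃ (pr₃ E₁ E₂ h)) +
      inj₃ E₁ E₂ (Y₃₁ (pr₁ E₁ E₂ h) + Y₃₂ (pr₂ E₁ E₂ h) + Y₃₃ (pr₃ E₁ E₂ h)) := rfl

theorem proj_apply_of_mem {U : Submodule ℂ E₁} [FiniteDimensional ℂ E₁] {x : E₁} (hx : x ∈ U) :
    proj U x = x :=
  Submodule.starProjection_eq_self_iff.mpr hx

theorem proj_apply_of_orthogonal {U : Submodule ℂ E₁} [FiniteDimensional ℂ E₁] {x : E₁}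
    (hx : ∀ u ∈ U, ⟪u, x⟫_ℂ = 0) : proj U x = 0 :=
  (Submodule.starProjection_apply_eq_zero_iff U).mpr ((Submodule.mem_orthogonal U x).mpr hx)

theorem inner_proj_self (U : Submodule ℂ E₁) [FiniteDimensional ℂ E₁] (x : E₁) :
    ⟪x, proj U x⟫_ℂ = ((‖proj U x‖ ^ 2 : ℝ) : ℂ) := by
  rw [proj]
  change ⟪x, U.starProjection x⟫_ℂ = ((‖U.starProjection x‖ ^ 2 : ℝ) : ℂ)
  rw [Complex.ofReal_pow, ← Complex.coe_algebraMap, ← inner_self_eq_norm_sq_to_K (𝕜 := ℂ),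
    Submodule.inner_starProjection_left_eq_right,
    Submodule.starProjection_eq_self_iff.mpr (Submodule.starProjection_apply_mem U x)]

/-- Cauchy–Schwarz after moving the projection from `a` to `x`. -/
theorem norm_inner_le_proj {U : Submodule ℂ E₁} [FiniteDimensional ℂ E₁] (x : E₁) {a : E₁}
    (ha : a ∈ U) : ‖⟪x, a⟫_ℂ‖ ≤ ‖proj U x‖ * ‖a‖ := by
  have h : ⟪x, a⟫_ℂ = ⟪proj U x, a⟫_ℂ := by
    conv_lhs => rw [← proj_apply_of_mem ha]
    exact (Submodule.inner_starProjection_left_eq_right U x a).symm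
  rw [h]
  exact norm_inner_le_norm _ _

end Coordinates

/-! ### Positivity and exposedness of the block map. -/

section BlockMap

variable {K₁ K₂ H₁ H₂ : Type*}
  [NormedAddCommGroup K₁] [InnerProductSpace ℂ K₁] [FiniteDimensional ℂ K₁]
  [NormedAddCommGroup K₂] [InnerProductSpace ℂ K₂] [FiniteDimensional ℂ K₂]
  [NormedAddCommGroup H₁] [InnerProductSpace ℂ H₁] [FiniteDimensional ℂ H₁]
  [NormedAddCommGroup H₂] [InnerProductSpace ℂ H₂] [FiniteDimensional ℂ H₂]
  (J₂ : Conjugation K₂) (A₁ : K₁ →ₗ[ℂ] H₁) (A₂ : K₂ →ₗ[ℂ] H₂) (θ₁ θ₂ ν : ℝ)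

theorem conj_exp_mul_I (θ : ℝ) :
    starRingEnd ℂ (Complex.exp (θ * Complex.I)) = Complex.exp (-(θ * Complex.I)) := by
  rw [← Complex.exp_conj]
  simp

theorem exp_neg_mul_exp (θ : ℝ) :
    Complex.exp (-(θ * Complex.I)) * Complex.exp (θ * Complex.I) = 1 := by
  rw [← Complex.exp_add]
  simp

/-- The value of the block map on a rank one operator `η η*`. -/
theorem blockMap_ketBra_apply (η : Sum₃ K₁ K₂) (h : Sum₃ H₁ H₂) {a : H₁} {b : H₂} {t : ℂ}
    (ha : a = Complex.exp (θ₁ * Complex.I) • A₁ (pr₁ K₁ K₂ η))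
    (hb : b = Complex.exp (θ₂ * Complex.I) • A₂ (J₂.conj (pr₂ K₁ K₂ η)))
    (ht : t = pr₃ K₁ K₂ η) :
    blockMap J₂ A₁ A₂ θ₁ θ₂ ν (ketBra η η) h =
      inj₁ H₁ H₂ (⟪a, pr₁ H₁ H₂ h⟫_ℂ • a +
        ((ν * ‖b‖ ^ 2 : ℝ) : ℂ) • proj (LinearMap.range A₁) (pr₁ H₁ H₂ h) +
        (starRingEnd ℂ t * pr₃ H₁ H₂ h) • a) +
      inj₂ H₁ H₂ (⟪b, pr₂ H₁ H₂ h⟫_ℂ • b +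
        ((ν⁻¹ * ‖a‖ ^ 2 : ℝ) : ℂ) • proj (LinearMap.range A₂) (pr₂ H₁ H₂ h) +
        (t * pr₃ H₁ H₂ h) • b) +
      inj₃ H₁ H₂ (t * ⟪a, pr₁ H₁ H₂ h⟫_ℂ + starRingEnd ℂ t * ⟪b, pr₂ H₁ H₂ h⟫_ℂ +
        t * starRingEnd ℂ t * pr₃ H₁ H₂ h) := by
  have hna : ‖a‖ = ‖A₁ (pr₁ K₁ K₂ η)‖ := by
    rw [ha, norm_smul, Complex.norm_exp_ofReal_mul_I, one_mul]
  have hnb : ‖b‖ = ‖A₂ (J₂.conj (pr₂ K₁ K₂ η))‖ := by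
    rw [hb, norm_smul, Complex.norm_exp_ofReal_mul_I, one_mul]
  have hcx : ∀ z, Conjugation.complex.conj z = starRingEnd ℂ z := fun _ => rfl
  have e1 := exp_neg_mul_exp θ₁
  have e2 := exp_neg_mul_exp θ₂
  rw [hna, hnb]
  change ofBlocks _ _ _ _ _ _ _ _ _ h = _
  simp only [ofBlocks_apply, block₁₁, block₁₃, block₂₂, block₂₃, block₃₁, block₃₂, block₃₃,
    ketBra_inj₁, ketBra_inj₂, ketBra_inj₃, comp_ketBra, transpose_ketBra, ketBra_comp_adjoint,
    trace_ketBra, LinearMap.zero_apply, add_zero, zero_add, LinearMap.add_apply,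
    LinearMap.smul_apply, ketBra_apply, hcx, ← ht]
  congr 2
  · congr 1
    rw [ha]
    simp only [inner_smul_left, conj_exp_mul_I, inner_self_eq_norm_sq_to_K, RCLike.inner_apply,
      Complex.coe_algebraMap]
    push_cast
    linear_combination (norm := module) (⟪A₁ (pr₁ K₁ K₂ η), pr₁ H₁ H₂ h⟫_ℂ •
      (congrArg (fun c : ℂ => c • A₁ (pr₁ K₁ K₂ η)) e1.symm))
  · congr 1
    rw [hb]
    simp only [inner_smul_left, conj_exp_mul_I, inner_self_eq_norm_sq_to_K, RCLike.inner_apply,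
      Complex.coe_algebraMap, Complex.conj_conj]
    push_cast
    linear_combination (norm := module) (⟪A₂ (J₂.conj (pr₂ K₁ K₂ η)), pr₂ H₁ H₂ h⟫_ℂ •
      (congrArg (fun c : ℂ => c • A₂ (J₂.conj (pr₂ K₁ K₂ η))) e2.symm))
  · rw [ha, hb]
    simp only [inner_smul_left, conj_exp_mul_I, RCLike.inner_apply, smul_eq_mul]
    ring

/-- With `p = |⟨x, a⟩|` and `q = |⟨y, b⟩|`, the form is at least `(p + q - |t||s|)² + (√ν ‖b‖‖P₁x‖ -
‖a‖‖P₂y‖/√ν)²`. The cross term `2pq` of the first square is paid for by that of the second, since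
`pq ≤ ‖P₁x‖‖a‖‖P₂y‖‖b‖`. -/
theorem blockMap_mem_positiveMaps (hν : 0 < ν) :
    blockMap J₂ A₁ A₂ θ₁ θ₂ ν ∈ positiveMaps (Sum₃ K₁ K₂) (Sum₃ H₁ H₂) := by
  refine mem_positiveMaps_of_ketBra fun η => ?_
  rw [LinearMap.isPositive_iff_complex]
  intro h
  obtain ⟨a, ha⟩ : ∃ a, a = Complex.exp (θ₁ * Complex.I) • A₁ (pr₁ K₁ K₂ η) := ⟨_, rfl⟩
  obtain ⟨b, hb⟩ : ∃ b, b = Complex.exp (θ₂ * Complex.I) • A₂ (J₂.conj (pr₂ K₁ K₂ η)) := ⟨_, rfl⟩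
  obtain ⟨t, ht⟩ : ∃ t, t = pr₃ K₁ K₂ η := ⟨_, rfl⟩
  have hmem : a ∈ LinearMap.range A₁ := by
    rw [ha]; exact Submodule.smul_mem _ _ ⟨_, rfl⟩
  have hmem' : b ∈ LinearMap.range A₂ := by
    rw [hb]; exact Submodule.smul_mem _ _ ⟨_, rfl⟩
  have hform := blockMap_ketBra_apply J₂ A₁ A₂ θ₁ θ₂ ν η h ha hb ht
  generalize blockMap J₂ A₁ A₂ θ₁ θ₂ ν (ketBra η η) h = k at hform
  obtain ⟨x, hx⟩ : ∃ x, x = pr₁ H₁ H₂ h := ⟨_, rfl⟩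
  obtain ⟨y, hy⟩ : ∃ y, y = pr₂ H₁ H₂ h := ⟨_, rfl⟩
  obtain ⟨s, hs⟩ : ∃ s, s = pr₃ H₁ H₂ h := ⟨_, rfl⟩
  rw [← hx, ← hy, ← hs] at hform
  have hquad : ⟪h, k⟫_ℂ = ((‖⟪x, a⟫_ℂ‖ ^ 2 + ‖⟪y, b⟫_ℂ‖ ^ 2 +
      ν * ‖b‖ ^ 2 * ‖proj (LinearMap.range A₁) x‖ ^ 2 +
      ν⁻¹ * ‖a‖ ^ 2 * ‖proj (LinearMap.range A₂) y‖ ^ 2 +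
      2 * (starRingEnd ℂ t * s * ⟪x, a⟫_ℂ).re + 2 * (t * s * ⟪y, b⟫_ℂ).re +
      (‖t‖ * ‖s‖) ^ 2 : ℝ) : ℂ) := by
    rw [hform, inner_sum₃, ← hx, ← hy, ← hs]
    simp only [map_add, pr₁_inj₁, pr₁_inj₂, pr₁_inj₃, pr₂_inj₁, pr₂_inj₂, pr₂_inj₃, pr₃_inj₁,
      pr₃_inj₂, pr₃_inj₃, add_zero, zero_add, inner_add_right, inner_smul_right, inner_proj_self]
    simp only [Complex.ofReal_add, Complex.ofReal_mul, mul_pow, Complex.ofReal_pow,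
      Complex.re_eq_add_conj, map_mul, Complex.conj_conj, inner_conj_symm,
      ← Complex.mul_conj', Complex.ofReal_ofNat]
    ring
  have hnn : 0 ≤ ‖⟪x, a⟫_ℂ‖ ^ 2 + ‖⟪y, b⟫_ℂ‖ ^ 2 +
      ν * ‖b‖ ^ 2 * ‖proj (LinearMap.range A₁) x‖ ^ 2 +
      ν⁻¹ * ‖a‖ ^ 2 * ‖proj (LinearMap.range A₂) y‖ ^ 2 +
      2 * (starRingEnd ℂ t * s * ⟪x, a⟫_ℂ).re + 2 * (t * s * ⟪y, b⟫_ℂ).re +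
      (‖t‖ * ‖s‖) ^ 2 := by
    have h1 := norm_inner_le_proj x hmem
    have h2 := norm_inner_le_proj y hmem'
    have h3 : -(‖t‖ * ‖s‖ * ‖⟪x, a⟫_ℂ‖) ≤ (starRingEnd ℂ t * s * ⟪x, a⟫_ℂ).re := by
      have := (abs_le.mp (Complex.abs_re_le_norm (starRingEnd ℂ t * s * ⟪x, a⟫_ℂ))).1
      simpa using this
    have h4 : -(‖t‖ * ‖s‖ * ‖⟪y, b⟫_ℂ‖) ≤ (t * s * ⟪y, b⟫_ℂ).re := by
      have := (abs_le.mp (Complex.abs_re_le_norm (t * s * ⟪y, b⟫_ℂ))).1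
      simpa using this
    have h5 : ‖⟪x, a⟫_ℂ‖ * ‖⟪y, b⟫_ℂ‖ ≤ (‖proj (LinearMap.range A₁) x‖ * ‖a‖) *
        (‖proj (LinearMap.range A₂) y‖ * ‖b‖) := by gcongr
    obtain ⟨r, hr, hr'⟩ : ∃ r : ℝ, 0 < r ∧ r ^ 2 = ν :=
      ⟨√ν, Real.sqrt_pos.mpr hν, Real.sq_sqrt hν.le⟩
    have h6 : (r * ‖b‖ * ‖proj (LinearMap.range A₁) x‖ -
        r⁻¹ * ‖a‖ * ‖proj (LinearMap.range A₂) y‖) ^ 2 =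
        ν * ‖b‖ ^ 2 * ‖proj (LinearMap.range A₁) x‖ ^ 2 +
        ν⁻¹ * ‖a‖ ^ 2 * ‖proj (LinearMap.range A₂) y‖ ^ 2 -
        2 * ((‖proj (LinearMap.range A₁) x‖ * ‖a‖) *
        (‖proj (LinearMap.range A₂) y‖ * ‖b‖)) := by
      rw [← hr']
      field_simp
      ring
    have h7 := sq_nonneg (r * ‖b‖ * ‖proj (LinearMap.range A₁) x‖ -
        r⁻¹ * ‖a‖ * ‖proj (LinearMap.range A₂) y‖)
    have h8 := sq_nonneg (‖⟪x, a⟫_ℂ‖ + ‖⟪y, b⟫_ℂ‖ - ‖t‖ * ‖s‖)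
    linarith
  rw [← inner_conj_symm k h, hquad, Complex.conj_ofReal]
  exact ⟨rfl, hnn⟩

theorem isExposedPositive_blockMap (J : Conjugation (Sum₃ H₁ H₂)) (hA₁ : A₁ ≠ 0) (hA₂ : A₂ ≠ 0)
    (hν : 0 < ν) : IsExposedPositive J (blockMap J₂ A₁ A₂ θ₁ θ₂ ν) := by
  have hφ := blockMap_mem_positiveMaps J₂ A₁ A₂ θ₁ θ₂ ν hν
  have happ := fun η h => blockMap_ketBra_apply J₂ A₁ A₂ θ₁ θ₂ ν η h rfl rfl rfl
  refine isExposedPositive_of_zeros J hφ fun ψ hψ hz => ?_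
  have hψee := (hψ _ (isPositive_ketBra (inj₃ K₁ K₂ 1))).re_inner_nonneg_right (inj₃ H₁ H₂ 1)
  -- The corresponding entry of the block map is `1`, so this is the only possible factor.
  obtain ⟨c, hc⟩ : ∃ c : ℝ,
      (c : ℂ) = ⟪inj₃ H₁ H₂ 1, ψ (ketBra (inj₃ K₁ K₂ 1) (inj₃ K₁ K₂ 1)) (inj₃ H₁ H₂ 1)⟫_ℂ := by
    have := (LinearMap.isPositive_iff_complex _).mp
      (hψ _ (isPositive_ketBra (inj₃ K₁ K₂ 1))) (inj₃ H₁ H₂ 1)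
    rw [positiveMaps_adjoint hψ] at this
    exact ⟨_, this.1⟩
  rw [← hc] at hψee
  refine ⟨c, by simpa using hψee, sub_eq_zero.mp ?_⟩
  have hz' : ∀ η h, blockMap J₂ A₁ A₂ θ₁ θ₂ ν (ketBra η η) h = 0 →
      (ψ - (c : ℂ) • blockMap J₂ A₁ A₂ θ₁ θ₂ ν) (ketBra η η) h = 0 := by
    intro η h h0
    rw [LinearMap.sub_apply, LinearMap.smul_apply, LinearMap.sub_apply, LinearMap.smul_apply, h0,
      hz η h h0, smul_zero, sub_zero]
  have exp_ne : ∀ θ : ℝ, Complex.exp (θ * Complex.I) ≠ 0 := fun _ => Complex.exp_ne_zero _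
  have orth₁ : ∀ h : Sum₃ H₁ H₂, (∀ η₁,
      ⟪(inj₁ H₁ H₂ ∘ₗ (Complex.exp (θ₁ * Complex.I) • A₁)) η₁, h⟫_ℂ = 0) →
      (∀ η₁, ⟪A₁ η₁, pr₁ H₁ H₂ h⟫_ℂ = 0) ∧ proj (LinearMap.range A₁) (pr₁ H₁ H₂ h) = 0 := by
    intro h h0
    have h1 : ∀ η₁, ⟪A₁ η₁, pr₁ H₁ H₂ h⟫_ℂ = 0 := by
      intro η₁
      have := h0 η₁
      rw [LinearMap.comp_apply, inner_inj₁, LinearMap.smul_apply, inner_smul_left] at this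
      exact (mul_eq_zero.mp this).resolve_left ((map_ne_zero _).mpr (exp_ne θ₁))
    refine ⟨h1, proj_apply_of_orthogonal ?_⟩
    rintro _ ⟨η₁, rfl⟩
    exact h1 η₁
  have orth₂ : ∀ h : Sum₃ H₁ H₂, (∀ η₂,
      ⟪((inj₂ H₁ H₂ ∘ₗ (Complex.exp (θ₂ * Complex.I) • A₂)).comp J₂.conj) η₂, h⟫_ℂ = 0) →
      (∀ η₂, ⟪A₂ η₂, pr₂ H₁ H₂ h⟫_ℂ = 0) ∧ proj (LinearMap.range A₂) (pr₂ H₁ H₂ h) = 0 := by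
    intro h h0
    have h1 : ∀ η₂, ⟪A₂ η₂, pr₂ H₁ H₂ h⟫_ℂ = 0 := by
      intro η₂
      -- As `J₂` is an involution, precomposing with it does not change the range.
      have := h0 (J₂.conj η₂)
      rw [LinearMap.comp_apply, J₂.conj_conj, LinearMap.comp_apply, inner_inj₂,
        LinearMap.smul_apply, inner_smul_left] at this
      exact (mul_eq_zero.mp this).resolve_left ((map_ne_zero _).mpr (exp_ne θ₂))
    refine ⟨h1, proj_apply_of_orthogonal ?_⟩
    rintro _ ⟨η₂, rfl⟩
    exact h1 η₂
  have pr₃_zero : ∀ h : Sum₃ H₁ H₂, ⟪inj₃ H₁ H₂ 1, h⟫_ℂ = 0 → pr₃ H₁ H₂ h = 0 := by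
    intro h h0
    rwa [inner_inj₃, map_one, one_mul] at h0
  refine eq_zero_of_common_zeros _ ?_ (inj₁ K₁ K₂) (inj₂ K₁ K₂) (inj₃ K₁ K₂ 1) ?_
    (inj₁ H₁ H₂ ∘ₗ (Complex.exp (θ₁ * Complex.I) • A₁))
    ((inj₂ H₁ H₂ ∘ₗ (Complex.exp (θ₂ * Complex.I) • A₂)).comp J₂.conj) (inj₃ H₁ H₂ 1) ?_ ?_ hν
    ?_ ?_ ?_ ?_ ?_
  · intro η ζ h k
    simp only [LinearMap.sub_apply, LinearMap.smul_apply, inner_sub_left, inner_sub_right,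
      inner_smul_left, inner_smul_right, Complex.conj_ofReal, positiveMaps_adjoint hψ,
      positiveMaps_adjoint hφ]
  · intro η
    refine ⟨pr₁ K₁ K₂ η, pr₂ K₁ K₂ η, pr₃ K₁ K₂ η, ?_⟩
    rw [← map_smul, smul_eq_mul, mul_one]
    exact sum₃_decomposition η
  · by_contra! h0
    refine hA₁ (LinearMap.ext fun η => ?_)
    have := congrArg (pr₁ H₁ H₂) (h0 η)
    rw [LinearMap.comp_apply, pr₁_inj₁, map_zero] at this
    exact (smul_eq_zero.mp this).resolve_left (exp_ne θ₁)
  · by_contra! h0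
    refine hA₂ (LinearMap.ext fun η => ?_)
    have := congrArg (pr₂ H₁ H₂) (h0 (J₂.conj η))
    rw [LinearMap.comp_apply, J₂.conj_conj, LinearMap.comp_apply, pr₂_inj₂, map_zero] at this
    exact (smul_eq_zero.mp this).resolve_left (exp_ne θ₂)
  -- The generic zero: for `x = -a`, `y = -νb`, `t = 1` and `s = ‖a‖² + ν‖b‖²`, both squares in the
  -- positivity bound vanish and Cauchy–Schwarz is an equality.
  · intro η₁ η₂
    refine hz' _ _ ?_
    obtain ⟨a, ha⟩ : ∃ a, a = Complex.exp (θ₁ * Complex.I) • A₁ η₁ := ⟨_, rfl⟩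
    obtain ⟨b, hb⟩ : ∃ b, b = Complex.exp (θ₂ * Complex.I) • A₂ (J₂.conj η₂) := ⟨_, rfl⟩
    have hmem : a ∈ LinearMap.range A₁ := by
      rw [ha]; exact Submodule.smul_mem _ _ ⟨_, rfl⟩
    have hmem' : b ∈ LinearMap.range A₂ := by
      rw [hb]; exact Submodule.smul_mem _ _ ⟨_, rfl⟩
    have hν0 : (ν : ℂ) ≠ 0 := by exact_mod_cast hν.ne'
    simp only [LinearMap.comp_apply, LinearMap.smul_apply, ← ha, ← hb]
    rw [blockMap_ketBra_apply J₂ A₁ A₂ θ₁ θ₂ ν _ _ (a := a) (b := b) (t := 1)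
      (by simp [ha, pr₁_inj₁, pr₁_inj₂, pr₁_inj₃]) (by simp [hb, pr₂_inj₁, pr₂_inj₂, pr₂_inj₃])
      (by simp [pr₃_inj₁, pr₃_inj₂, pr₃_inj₃])]
    simp only [map_add, map_sub, map_neg, map_smul,
      pr₁_inj₁, pr₁_inj₂, pr₁_inj₃, pr₂_inj₁, pr₂_inj₂, pr₂_inj₃, pr₃_inj₁,
      pr₃_inj₂, pr₃_inj₃, add_zero, map_one, smul_zero, sub_zero, neg_zero,
      zero_sub, norm_inj₁, norm_inj₂, one_mul, proj_apply_of_mem hmem, proj_apply_of_mem hmem',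
      smul_eq_mul, mul_one, inner_neg_right, inner_smul_right, inner_self_eq_norm_sq_to_K,
      Complex.coe_algebraMap]
    have hsmul : ∀ z : ℂ, inj₃ H₁ H₂ z = z • inj₃ H₁ H₂ 1 := by
      intro z
      rw [← map_smul, smul_eq_mul, mul_one]
    rw [hsmul (_ ^ 2), hsmul (ν * _ ^ 2), hsmul (ν * 0), hsmul (Complex.ofReal _)]
    push_cast
    match_scalars <;> field_simp <;> ring
  · intro η h h1 h2 h3
    refine hz' _ _ ?_
    rw [happ, (orth₁ h h1).2, (orth₂ h h2).2, pr₃_zero h h3, inner_smul_left, inner_smul_left,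
      (orth₁ h h1).1, (orth₂ h h2).1]
    simp
  · intro η₁ h h1 h2 h3
    refine hz' _ _ ?_
    rw [LinearMap.comp_apply, inner_inj₁, LinearMap.smul_apply] at h1
    rw [happ, (orth₂ h h2).2, pr₃_zero h h3, pr₁_inj₁, pr₂_inj₁, pr₃_inj₁, h1]
    simp
  · intro η₂ h h1 h2 h3
    refine hz' _ _ ?_
    rw [LinearMap.comp_apply, LinearMap.comp_apply, inner_inj₂, LinearMap.smul_apply] at h2
    rw [happ, (orth₁ h h1).2, pr₃_zero h h3, pr₁_inj₂, pr₂_inj₂, pr₃_inj₂, h2]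
    simp
  · rw [LinearMap.sub_apply, LinearMap.smul_apply, LinearMap.sub_apply, LinearMap.smul_apply,
      inner_sub_right, inner_smul_right, ← hc, happ, inner_inj₃]
    simp [pr₁_inj₃, pr₂_inj₃, pr₃_inj₃]

end BlockMap

end Merging

namespace Merging

/-! ### Canonical mergings as block maps. -/

section CanonicalMerging

variable {K₁ K₂ H₁ H₂ : Type*}
  [NormedAddCommGroup K₁] [InnerProductSpace ℂ K₁] [FiniteDimensional ℂ K₁]
  [NormedAddCommGroup K₂] [InnerProductSpace ℂ K₂] [FiniteDimensional ℂ K₂]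
  [NormedAddCommGroup H₁] [InnerProductSpace ℂ H₁] [FiniteDimensional ℂ H₁]
  [NormedAddCommGroup H₂] [InnerProductSpace ℂ H₂] [FiniteDimensional ℂ H₂]

theorem adMap_ketBra_apply (A : K₁ →ₗ[ℂ] H₁) (η ξ : K₁) (x : H₁) :
    adMap A (ketBra η ξ) x = ⟪A ξ, x⟫_ℂ • A η := by
  change (A ∘ₗ ketBra η ξ ∘ₗ LinearMap.adjoint A) x = _
  rw [ketBra_comp_adjoint, comp_ketBra, ketBra_apply]

theorem coAdMap_ketBra_apply (J : Conjugation K₁) (A : K₁ →ₗ[ℂ] H₁) (η ξ : K₁) (x : H₁) :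
    coAdMap J A (ketBra η ξ) x = ⟪A (J.conj η), x⟫_ℂ • A (J.conj ξ) := by
  rw [coAdMap, LinearMap.comp_apply, transpose_ketBra, adMap_ketBra_apply]

/-- Pairing the eigenvector equation with `x` gives `|⟨u, x⟩|² = r`. The resulting unit scalar is
the factor relating `opB` or `opC` to `A`. -/
theorem exists_phase {u x : H₁} {r : ℝ} (hx : ‖x‖ = 1) (hr : 0 < r)
    (h : ⟪u, x⟫_ℂ • u = (r : ℂ) • x) :
    ∃ θ : ℝ, ((Real.sqrt r)⁻¹ : ℂ) * ⟪u, x⟫_ℂ = Complex.exp (θ * Complex.I) := by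
  have h1 := congrArg (fun v => ⟪x, v⟫_ℂ) h
  simp only [inner_smul_right, inner_self_eq_norm_sq_to_K, hx] at h1
  rw [← inner_conj_symm x u, Complex.mul_conj'] at h1
  have h2 : ‖⟪u, x⟫_ℂ‖ ^ 2 = r := by
    apply Complex.ofReal_injective
    simpa using h1
  have h3 : ‖((Real.sqrt r)⁻¹ : ℂ) * ⟪u, x⟫_ℂ‖ = 1 := by
    rw [norm_mul, norm_inv, Complex.norm_real, Real.norm_of_nonneg (Real.sqrt_nonneg r), ← h2,
      Real.sqrt_sq (norm_nonneg _), inv_mul_cancel₀]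
    intro h0
    rw [h0] at h2
    norm_num at h2
    exact hr.ne h2
  obtain ⟨θ, hθ⟩ := (Complex.norm_eq_one_iff _).mp h3
  exact ⟨θ, hθ.symm⟩

theorem opB_adMap (A : K₁ →ₗ[ℂ] H₁) (ξ : K₁) (x : H₁) (r : ℝ) :
    opB (adMap A) ξ x r = (((Real.sqrt r)⁻¹ : ℂ) * ⟪A ξ, x⟫_ℂ) • A := by
  ext η
  change ((Real.sqrt r)⁻¹ : ℂ) • adMap A (ketBra η ξ) x = _
  rw [adMap_ketBra_apply, smul_smul, LinearMap.smul_apply]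

theorem opC_coAdMap (J : Conjugation K₁) (A : K₁ →ₗ[ℂ] H₁) (ξ : K₁) (x : H₁) (r : ℝ) :
    opC J (coAdMap J A) ξ x r = (((Real.sqrt r)⁻¹ : ℂ) * ⟪A (J.conj ξ), x⟫_ℂ) • A := by
  ext η
  change ((Real.sqrt r)⁻¹ : ℂ) • coAdMap J A (ketBra ξ (J.conj η)) x = _
  rw [coAdMap_ketBra_apply, smul_smul, LinearMap.smul_apply, J.conj_conj]

theorem adMap_phase (A : K₁ →ₗ[ℂ] H₁) (θ : ℝ) :
    adMap (Complex.exp (θ * Complex.I) • A) = adMap A := by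
  ext X x
  change (Complex.exp (θ * Complex.I) • A)
    (X (LinearMap.adjoint (Complex.exp (θ * Complex.I) • A) x)) = A (X (LinearMap.adjoint A x))
  rw [map_smulₛₗ, conj_exp_mul_I]
  simp only [LinearMap.smul_apply, map_smul, smul_smul]
  rw [exp_neg_mul_exp, one_smul]

theorem coAdMap_phase (J : Conjugation K₁) (A : K₁ →ₗ[ℂ] H₁) (θ : ℝ) :
    coAdMap J (Complex.exp (θ * Complex.I) • A) = coAdMap J A := by
  rw [coAdMap, coAdMap, adMap_phase]

theorem transpose_id (J : Conjugation K₁) : transpose J J LinearMap.id = LinearMap.id := by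
  ext x
  change J.conj (LinearMap.adjoint LinearMap.id (J.conj x)) = x
  rw [LinearMap.adjoint_id, LinearMap.id_apply, J.conj_conj]

theorem range_adMap_id (A : K₁ →ₗ[ℂ] H₁) :
    LinearMap.range (adMap A LinearMap.id) = LinearMap.range A :=
  LinearMap.range_self_comp_adjoint A

theorem range_coAdMap_id (J : Conjugation K₁) (A : K₁ →ₗ[ℂ] H₁) :
    LinearMap.range (coAdMap J A LinearMap.id) = LinearMap.range A := by
  rw [coAdMap, LinearMap.comp_apply, transpose_id, range_adMap_id]

/-- A canonical merging of `X ↦ A₁ X A₁*` and `X ↦ A₂ Xᵀ A₂*` is a block map with `ν = 1`. -/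
theorem exists_blockMap_of_isCanonicalMerging {J₁ : Conjugation K₁} {J₂ : Conjugation K₂}
    {A₁ : K₁ →ₗ[ℂ] H₁} {A₂ : K₂ →ₗ[ℂ] H₂}
    {φ : (Sum₃ K₁ K₂ →ₗ[ℂ] Sum₃ K₁ K₂) →ₗ[ℂ] (Sum₃ H₁ H₂ →ₗ[ℂ] Sum₃ H₁ H₂)}
    (h : IsCanonicalMerging J₁ J₂ (adMap A₁) (coAdMap J₂ A₂) φ) :
    ∃ θ₁ θ₂ : ℝ, φ = blockMap J₂ A₁ A₂ θ₁ θ₂ 1 := by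
  obtain ⟨ξ₁, x₁, r₁, ξ₂, x₂, r₂, -, hx₁, hr₁, h₁, -, hx₂, hr₂, h₂, rfl⟩ := h
  rw [adMap_ketBra_apply] at h₁
  rw [coAdMap_ketBra_apply] at h₂
  obtain ⟨θ₁, hθ₁⟩ := exists_phase hx₁ hr₁ h₁
  obtain ⟨θ₂, hθ₂⟩ := exists_phase hx₂ hr₂ h₂
  refine ⟨θ₁, θ₂, LinearMap.ext fun X => ?_⟩
  rw [opB_adMap, opC_coAdMap, hθ₁, hθ₂, adMap_phase, coAdMap_phase]
  change ofBlocks _ _ _ _ _ _ _ _ _ = ofBlocks _ _ _ _ _ _ _ _ _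
  rw [range_adMap_id, range_coAdMap_id]
  simp only [map_smulₛₗ, conj_exp_mul_I, map_zero, LinearMap.zero_comp, LinearMap.comp_zero,
    add_zero, zero_add, LinearMap.smul_comp, LinearMap.comp_smul, Complex.ofReal_one, inv_one,
    one_mul]
  rfl

end CanonicalMerging

end Merging

/-- First part: the block map is an exposed positive map. Second part: in particular, every
canonical merging of `X ↦ A₁ X A₁*` and `X ↦ A₂ Xᵀ A₂*` is an exposed positive map. -/
theorem theorem4p2
    {K₁ K₂ H₁ H₂ : Type*}
    [NormedAddCommGroup K₁] [InnerProductSpace ℂ K₁] [FiniteDimensional ℂ K₁]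
    [NormedAddCommGroup K₂] [InnerProductSpace ℂ K₂] [FiniteDimensional ℂ K₂]
    [NormedAddCommGroup H₁] [InnerProductSpace ℂ H₁] [FiniteDimensional ℂ H₁]
    [NormedAddCommGroup H₂] [InnerProductSpace ℂ H₂] [FiniteDimensional ℂ H₂]
    (J₁ : Merging.Conjugation K₁) (J₂ : Merging.Conjugation K₂)
    (L₁ : Merging.Conjugation H₁) (L₂ : Merging.Conjugation H₂)
    (A₁ : K₁ →ₗ[ℂ] H₁) (A₂ : K₂ →ₗ[ℂ] H₂) (hA₁ : A₁ ≠ 0) (hA₂ : A₂ ≠ 0) :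
    (∀ θ₁ θ₂ ν : ℝ, 0 < ν →
      Merging.IsExposedPositive (L₁.sum₃ L₂) (Merging.blockMap J₂ A₁ A₂ θ₁ θ₂ ν)) ∧
    (∀ φ : (Merging.Sum₃ K₁ K₂ →ₗ[ℂ] Merging.Sum₃ K₁ K₂) →ₗ[ℂ]
        (Merging.Sum₃ H₁ H₂ →ₗ[ℂ] Merging.Sum₃ H₁ H₂),
      Merging.IsCanonicalMerging J₁ J₂ (Merging.adMap A₁) (Merging.coAdMap J₂ A₂) φ →
        Merging.IsExposedPositive (L₁.sum₃ L₂) φ) := by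
  refine ⟨fun θ₁ θ₂ ν hν =>
    Merging.isExposedPositive_blockMap J₂ A₁ A₂ θ₁ θ₂ ν _ hA₁ hA₂ hν, fun φ hφ => ?_⟩
  obtain ⟨θ₁, θ₂, rfl⟩ := Merging.exists_blockMap_of_isCanonicalMerging hφ
  exact Merging.isExposedPositive_blockMap J₂ A₁ A₂ θ₁ θ₂ 1 _ hA₁ hA₂ one_pos
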